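/- Let $D\subset\mathbb R^d$ be open and bounded, $T>0$, $\alpha\in(1/2,1)$, and let $\mathcal A u=-\sum_{i,j}a^{ij}u_{x_ix_j}+\sum_i b^iu_{x_i}+cu$ with $a^{ij},b^i,c\in C^\infty(\mathbb R^d)$ be uniformly elliptic on $D$, and symmetric and positive definite on $H^2(D)\cap H^1_0(D)$ with respect to the inner product of $L^2(D)$. Let $\{(\lambda_n,\phi_n)\}_{n\ge1}$ be its Dirichlet eigensystem: $0<\lambda_1\le\lambda_2\le\cdots$, $\phi_n\in H^2(D)\cap H^1_0(D)$, $\mathcal A\phi_n=\lambda_n\phi_n$, and $(\phi_n)$ is an orthonormal basis of $L^2(D)$. Let $h\in L^\infty(0,T)$ with $h\ge c_h>0$ a.e., let $\mathbb W$ be a standard Wiener process on a probability space, and let $E_{\alpha,\beta}(z)=\sum_{k\ge0}z^k/\Gamma(k\alpha+\beta)$. For $f,g\in L^2(D)$ put $f_n=\langle f,\phi_n\rangle_{L^2(D)}$, $g_n=\langle g,\phi_n\rangle_{L^2(D)}$, and let $$u(\cdot,t)=\sum_{n\ge1}\Big(f_n\int_0^t(t-\tau)^{\alpha-1}E_{\alpha,\alpha}(-\lambda_n(t-\tau)^\alpha)h(\tau)\,d\tau+g_n\int_0^t(t-\tau)^{\alpha-1}E_{\alpha,\alpha}(-\lambda_n(t-\tau)^\alpha)\,d\mathbb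 W(\tau)\Big)\phi_n,\qquad 0\le t\le T,$$ be the mild solution of $\partial_t^\alpha u+\mathcal Au=f(x)h(t)+g(x)\dot{\mathbb W}(t)$ in $D\times(0,T]$ with zero initial and Dirichlet boundary data ($\partial_t^\alpha$ the Caputo derivative). Write $u_n(T)=\langle u(\cdot,T),\phi_n\rangle_{L^2(D)}$ and $$M_n=\int_0^T\tau^{\alpha-1}E_{\alpha,\alpha}(-\lambda_n\tau^\alpha)h(T-\tau)\,d\tau,\qquad K_{m,n}=\int_0^T\tau^{2\alpha-2}E_{\alpha,\alpha}(-\lambda_m\tau^\alpha)E_{\alpha,\alpha}(-\lambda_n\tau^\alpha)\,d\tau .$$ Suppose $f,g\in L^2(D)$, $g\neq0$, $g\in H^2(D)$, and let $N_0$ be an index with $g_{N_0}\ne0$. Then the random variables $u_n(T)$ are square integrable, $M_n>0$ and $K_{N_0,n}>0$ for all $n$, $\mathbb V(u_{N_0}(T))>0$, and $$f_n=\frac{\mathbb E\,u_n(T)}{M_n}\ \ (n\ge1),\qquad |g_{N_0}|=\sqrt{\mathbb V(u_{N_0}(T))/K_{N_0,N_0}},$$ and there is a sign $s\in\{1,-1\}$,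 independent of $n$, with $$s\,g_n=\frac{\mathrm{Cov}(u_{N_0}(T),u_n(T))}{\sqrt{\mathbb V(u_{N_0}(T))/K_{N_0,N_0}}\;K_{N_0,n}}\quad(n\ge1).$$ Consequently the data $\{\mathbb E\,u_n(T),\ \mathbb V(u_{N_0}(T)),\ \mathrm{Cov}(u_{N_0}(T),u_n(T)):n\ge1\}$ determine $f$ and $|g|$ uniquely: if $f'\in L^2(D)$ and $g'\in H^2(D)$ give a mild solution (with the same $h$ and $\mathbb W$) with the same data, then $f'=f$, $g'=g$ or $g'=-g$, and hence $|g'|=|g|$ in $L^2(D)$. -/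

import Mathlib

open MeasureTheory ProbabilityTheory Filter Set
open scoped NNReal ENNReal Topology Distributions

noncomputable section

namespace SFDE

/-! ### Sobolev spaces on an open set -/

variable {d : ℕ}

/-- The real Hilbert space `L²(D)` of an open set `D ⊆ ℝᵈ`. -/
abbrev L2 (D : TopologicalSpace.Opens (EuclideanSpace ℝ (Fin d))) : Type :=
  Lp ℝ 2 (volume.restrict (D : Set (EuclideanSpace ℝ (Fin d))))

/-- The classical partial derivative in the `i`-th coordinate. -/
def partialDeriv (i : Fin d) (ψ : EuclideanSpace ℝ (Fin d) → ℝ)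
    (x : EuclideanSpace ℝ (Fin d)) : ℝ :=
  fderiv ℝ ψ x (EuclideanSpace.single i 1)

variable {D : TopologicalSpace.Opens (EuclideanSpace ℝ (Fin d))}

/-- `v ∈ L²(D)` is the weak `i`-th partial derivative of `u ∈ L²(D)`. -/
def IsWeakPartial (i : Fin d) (u v : L2 D) : Prop :=
  ∀ ψ : 𝓓(D, ℝ),
    ∫ x in (D : Set (EuclideanSpace ℝ (Fin d))), u x * partialDeriv i ψ x
      = - ∫ x in (D : Set (EuclideanSpace ℝ (Fin d))), v x * ψ x

open Classical in
/-- The weak `i`-th partial derivative in `L²(D)` (it is unique when it exists; `0` otherwise). -/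
def weakPartial (i : Fin d) (u : L2 D) : L2 D :=
  if hu : ∃ v : L2 D, IsWeakPartial i u v then hu.choose else 0

/-- `u ∈ H¹(D)`. -/
def MemH1 (u : L2 D) : Prop :=
  ∀ i : Fin d, ∃ v : L2 D, IsWeakPartial i u v

/-- `u ∈ H²(D)`. -/
def MemH2 (u : L2 D) : Prop :=
  MemH1 u ∧ ∀ i : Fin d, MemH1 (weakPartial i u)

/-- `u ∈ H¹₀(D)`: `u` lies in the closure of the test functions for the `H¹(D)`-norm. -/
def MemH10 (u : L2 D) : Prop :=
  MemH1 u ∧ ∀ ε : ℝ≥0∞, 0 < ε → ∃ ψ : 𝓓(D, ℝ),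
    eLpNorm (fun x => ψ x - u x) 2
        (volume.restrict (D : Set (EuclideanSpace ℝ (Fin d)))) < ε ∧
      ∀ i : Fin d, eLpNorm (fun x => partialDeriv i ψ x - weakPartial i u x) 2
        (volume.restrict (D : Set (EuclideanSpace ℝ (Fin d)))) < ε

/-! ### The elliptic operator and its eigensystem -/

/-- The coefficients of `𝒜 u = -∑ aⁱʲ u_{xᵢxⱼ} + ∑ bⁱ u_{xᵢ} + c u`, smooth on `ℝᵈ`. -/
structure DiffOperator (d : ℕ) where
  a : Fin d → Fin d → EuclideanSpace ℝ (Fin d) → ℝ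
  b : Fin d → EuclideanSpace ℝ (Fin d) → ℝ
  c : EuclideanSpace ℝ (Fin d) → ℝ
  contDiff_a : ∀ i j, ContDiff ℝ (⊤ : ℕ∞) (a i j)
  contDiff_b : ∀ i, ContDiff ℝ (⊤ : ℕ∞) (b i)
  contDiff_c : ContDiff ℝ (⊤ : ℕ∞) c

/-- `𝒜 u` for `u ∈ H²(D)`, as a function on `D` (up to null sets). -/
def DiffOperator.apply (A : DiffOperator d) (u : L2 D) (x : EuclideanSpace ℝ (Fin d)) : ℝ :=
  -(∑ i, ∑ j, A.a i j x * weakPartial j (weakPartial i u) x)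
    + ∑ i, A.b i x * weakPartial i u x + A.c x * u x

/-- `𝒜` is (uniformly) elliptic on `D`, and symmetric and positive definite on
`H²(D) ∩ H¹₀(D)` for the inner product of `L²(D)`. -/
structure DiffOperator.IsAdmissible (A : DiffOperator d)
    (D : TopologicalSpace.Opens (EuclideanSpace ℝ (Fin d))) : Prop where
  elliptic : ∃ θ : ℝ, 0 < θ ∧ ∀ x ∈ D, ∀ ξ : EuclideanSpace ℝ (Fin d),
    θ * ‖ξ‖ ^ 2 ≤ ∑ i, ∑ j, A.a i j x * ξ i * ξ j
  symmetric : ∀ u v : L2 D, MemH2 u → MemH10 u → MemH2 v → MemH10 v →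
    ∫ x in (D : Set (EuclideanSpace ℝ (Fin d))), A.apply u x * v x
      = ∫ x in (D : Set (EuclideanSpace ℝ (Fin d))), u x * A.apply v x
  posDef : ∀ u : L2 D, MemH2 u → MemH10 u → u ≠ 0 →
    0 < ∫ x in (D : Set (EuclideanSpace ℝ (Fin d))), A.apply u x * u x

/-- `(lam n, φ n)` is the Dirichlet eigensystem of `𝒜` on `D`: the eigenvalues are positive and
listed in increasing order with multiplicity, the eigenfunctions lie in `H²(D) ∩ H¹₀(D)` and
form an orthonormal basis of `L²(D)`. Indices start at `0`. -/
structure IsEigensystem (A : DiffOperator d) (lam : ℕ → ℝ) (φ : HilbertBasis ℕ ℝ (L2 D)) :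
    Prop where
  pos : ∀ n, 0 < lam n
  mono : Monotone lam
  memH2 : ∀ n, MemH2 (φ n)
  memH10 : ∀ n, MemH10 (φ n)
  eigen : ∀ n, ∀ᵐ x ∂(volume.restrict (D : Set (EuclideanSpace ℝ (Fin d)))),
    A.apply (φ n) x = lam n * φ n x

/-! ### Mittag-Leffler function -/

/-- The Mittag-Leffler function `E_{α,β}` on the real line. -/
def mittagLeffler (α β z : ℝ) : ℝ :=
  ∑' k : ℕ, z ^ k / Real.Gamma (k * α + β)

/-- The kernel `τ ↦ τ^{α-1} E_{α,α}(-μ τ^α)`. -/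
def kernel (α μ τ : ℝ) : ℝ :=
  τ ^ (α - 1) * mittagLeffler α α (-μ * τ ^ α)

/-! ### Wiener integral of a deterministic function -/

/-- A (left-open) step function `∑ cᵢ 1_{(aᵢ, bᵢ]}` on `(0, t]`. -/
structure StepFn (t : ℝ) where
  m : ℕ
  c : Fin m → ℝ
  a : Fin m → ℝ≥0
  b : Fin m → ℝ≥0
  a_le_b : ∀ i, a i ≤ b i
  b_le : ∀ i, (b i : ℝ) ≤ t

/-- The underlying function of a step function. -/
def StepFn.eval {t : ℝ} (s : StepFn t) (τ : ℝ) : ℝ :=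
  ∑ i, (Ioc (s.a i : ℝ) (s.b i)).indicator (fun _ => s.c i) τ

variable {Ω : Type*} [MeasurableSpace Ω]

/-- The Wiener integral `∑ cᵢ (W(bᵢ) - W(aᵢ))` of a step function. -/
def StepFn.wiener {t : ℝ} (s : StepFn t) (W : ℝ≥0 → Ω → ℝ) (ω : Ω) : ℝ :=
  ∑ i, s.c i * (W (s.b i) ω - W (s.a i) ω)

/-- `X` is (a version of) `∫₀ᵗ k(τ) dW(τ)`: it is the `L²(P)`-limit of the integrals of step
functions that converge to `k` in `L²(0, t)`. -/
def IsWienerIntegral (W : ℝ≥0 → Ω → ℝ) (P : Measure Ω) (t : ℝ) (k : ℝ → ℝ) (X : Ω → ℝ) : Prop :=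
  MemLp X 2 P ∧ ∃ s : ℕ → StepFn t,
    Tendsto (fun j => eLpNorm (fun τ => (s j).eval τ - k τ) 2 (volume.restrict (Ioc 0 t)))
      atTop (𝓝 0) ∧
    Tendsto (fun j => eLpNorm (fun ω => (s j).wiener W ω - X ω) 2 P) atTop (𝓝 0)

open Classical in
/-- The Wiener integral `∫₀ᵗ k(τ) dW(τ)` of a deterministic `k ∈ L²(0, t)`. It is determined
up to `P`-null sets. -/
def wienerIntegral (W : ℝ≥0 → Ω → ℝ) (P : Measure Ω) (t : ℝ) (k : ℝ → ℝ) : Ω → ℝ :=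
  if hX : ∃ X : Ω → ℝ, IsWienerIntegral W P t k X then hX.choose else 0

/-! ### The mild solution -/

/-- The deterministic part `I_{n,1}(t)`, for the coefficient `fn = ⟨f, φ_n⟩` and the
eigenvalue `μ = λ_n`. -/
def detPart (α μ fn : ℝ) (h : ℝ → ℝ) (t : ℝ) : ℝ :=
  fn * ∫ τ in (0 : ℝ)..t, kernel α μ (t - τ) * h τ

/-- The stochastic part `I_{n,2}(t)`, for the coefficient `gn = ⟨g, φ_n⟩` and the
eigenvalue `μ = λ_n`. -/
def stochPart (α μ gn : ℝ) (W : ℝ≥0 → Ω → ℝ) (P : Measure Ω) (t : ℝ) (ω : Ω) : ℝ :=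
  gn * wienerIntegral W P t (fun τ => kernel α μ (t - τ)) ω

/-- `u` is (a version of) the mild solution `∑ₙ (I_{n,1}(t) + I_{n,2}(t)) φ_n` on `[0, T]`, the
series being taken in `L²(D)`. -/
def IsMildSolution (α T : ℝ) (lam : ℕ → ℝ) (φ : HilbertBasis ℕ ℝ (L2 D)) (h : ℝ → ℝ)
    (W : ℝ≥0 → Ω → ℝ) (P : Measure Ω) (f g : L2 D) (u : ℝ → Ω → L2 D) : Prop :=
  ∀ t ∈ Icc 0 T, ∀ᵐ ω ∂P,
    u t ω = ∑' n, (detPart α (lam n) (inner ℝ f (φ n)) h t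
      + stochPart α (lam n) (inner ℝ g (φ n)) W P t ω) • φ n

/-- The random variable `u_n(t) = ⟨u(·, t), φ_n⟩`. -/
def coeff (φ : HilbertBasis ℕ ℝ (L2 D)) (u : ℝ → Ω → L2 D) (n : ℕ) (t : ℝ) (ω : Ω) : ℝ :=
  inner ℝ (u t ω) (φ n)

/-- `∫₀ᵀ τ^{α-1} E_{α,α}(-μ τ^α) h(T-τ) dτ`. -/
def meanWeight (α T μ : ℝ) (h : ℝ → ℝ) : ℝ :=
  ∫ τ in (0 : ℝ)..T, τ ^ (α - 1) * mittagLeffler α α (-μ * τ ^ α) * h (T - τ)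

/-- `∫₀ᵀ τ^{2α-2} E_{α,α}(-μ τ^α) E_{α,α}(-ν τ^α) dτ`. -/
def covWeight (α T μ ν : ℝ) : ℝ :=
  ∫ τ in (0 : ℝ)..T, τ ^ (2 * α - 2) * mittagLeffler α α (-μ * τ ^ α)
    * mittagLeffler α α (-ν * τ ^ α)

end SFDE

end

namespace SFDE

/-!
On the coefficients, `u_n(T) = f_n M_n + g_n S_n` almost surely, where `S_n` is the Wiener integral
of the kernel `τ ↦ (T-τ)^(α-1) E_{α,α}(-λ_n (T-τ)^α)`. Wiener integrals are centred, and by Itô's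
isometry `Cov(S_m, S_n) = K_{m,n}`, so `𝔼 u_n(T) = f_n M_n` and
`Cov(u_N(T), u_n(T)) = g_N g_n K_{N,n}`. The data can be inverted because the weights are positive,
which comes down to `E_{α,α}(-x) > 0` for `x ≥ 0`.

For that positivity, `e(t) = E_{α,α}(-t^α)` satisfies the Volterra equation
`∫₀ᵗ s^(α-1) (t-s)^(α-1) e(s) ds = t^(α-1) (1 - Γ(α) e(t))`. Suppose that `e` has a first zero `r`.
For `t < r`, comparing `(r-s)^(α-1)` with `(t-s)^(α-1)` on `(0, t)` gives
`Γ(α) r^(α-1) e(t) ≤ ∫_t^r s^(α-1) (r-s)^(α-1) e(s) ds`. The weight has arbitrarily small mass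
near `r`, which contradicts this at a maximum point of `e` on a short interval `[c, r]`.
-/

/-! ### Mittag-Leffler functions -/

lemma exp_mul_rpow_le_Gamma {R x : ℝ} (hR : 0 ≤ R) (hx : 1 ≤ x) :
    Real.exp (-(R + 1)) * R ^ (x - 1) ≤ Real.Gamma x := by
  have hint := Real.GammaIntegral_convergent (s := x) (by linarith)
  have hsub : Ioc R (R + 1) ⊆ Ioi 0 := fun y hy => hR.trans_lt hy.1
  rw [Real.Gamma_eq_integral (by linarith)]
  calc Real.exp (-(R + 1)) * R ^ (x - 1)
      = ∫ _ in Ioc R (R + 1), Real.exp (-(R + 1)) * R ^ (x - 1) := by simp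
    _ ≤ ∫ y in Ioc R (R + 1), Real.exp (-y) * y ^ (x - 1) := by
        refine setIntegral_mono_on (integrableOn_const (by simp)) (hint.mono_set hsub)
          measurableSet_Ioc fun y hy => ?_
        have hpow : R ^ (x - 1) ≤ y ^ (x - 1) := Real.rpow_le_rpow hR hy.1.le (by linarith)
        have hexp : Real.exp (-(R + 1)) ≤ Real.exp (-y) := Real.exp_le_exp.2 (by linarith [hy.2])
        gcongr
    _ ≤ ∫ y in Ioi 0, Real.exp (-y) * y ^ (x - 1) := by
        refine setIntegral_mono_set hint ?_ hsub.eventuallyLE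
        filter_upwards [ae_restrict_mem measurableSet_Ioi] with y (hy : 0 < y)
        positivity

section MittagLeffler

variable {α β : ℝ}

lemma Gamma_natCast_mul_add_pos (hα : 0 ≤ α) (hβ : 0 < β) (k : ℕ) :
    0 < Real.Gamma (k * α + β) :=
  Real.Gamma_pos_of_pos (by positivity)

lemma summable_pow_div_Gamma (hα : 0 < α) (hβ : 0 < β) (z : ℝ) :
    Summable fun k : ℕ => z ^ k / Real.Gamma (k * α + β) := by
  obtain ⟨R, hR, hRα⟩ : ∃ R : ℝ, 0 < R ∧ R ^ α = 2 * (|z| + 1) :=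
    ⟨(2 * (|z| + 1)) ^ α⁻¹, by positivity, Real.rpow_inv_rpow (by positivity) hα.ne'⟩
  obtain ⟨N, hN⟩ := exists_nat_ge α⁻¹
  refine Summable.of_norm_bounded_eventually_nat
    ((summable_geometric_of_lt_one (by norm_num) one_half_lt_one).mul_left
      (Real.exp (R + 1) * R ^ (1 - β))) ?_
  filter_upwards [eventually_ge_atTop N] with k hk
  have hG := Gamma_natCast_mul_add_pos hα.le hβ k
  have hx : (1 : ℝ) ≤ k * α + β := by
    have hkα : α⁻¹ ≤ (k : ℝ) := hN.trans (by exact_mod_cast hk)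
    linarith [(inv_le_iff_one_le_mul₀ hα).1 hkα]
  have hpow : (R ^ α) ^ k = R ^ (1 - β) * R ^ (k * α + β - 1) := by
    rw [← Real.rpow_natCast, ← Real.rpow_mul hR.le, ← Real.rpow_add hR]
    ring_nf
  have hexp : Real.exp (R + 1) * Real.exp (-(R + 1)) = 1 := by rw [← Real.exp_add]; simp
  rw [norm_div, norm_pow, Real.norm_of_nonneg hG.le, Real.norm_eq_abs, div_le_iff₀ hG]
  calc |z| ^ k ≤ ((1 / 2) * R ^ α) ^ k := by gcongr; linarith [abs_nonneg z]
    _ = Real.exp (R + 1) * R ^ (1 - β) * (1 / 2) ^ k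
          * (Real.exp (-(R + 1)) * R ^ (k * α + β - 1)) := by
        rw [mul_pow, hpow]
        linear_combination (-(1 / 2 : ℝ) ^ k * R ^ (1 - β) * R ^ (k * α + β - 1)) * hexp
    _ ≤ _ := by gcongr; exact exp_mul_rpow_le_Gamma hR.le hx

lemma continuous_mittagLeffler (hα : 0 < α) (hβ : 0 < β) : Continuous (mittagLeffler α β) := by
  refine continuous_iff_continuousAt.2 fun z₀ => ?_
  have hcont : ContinuousOn (mittagLeffler α β) (Metric.ball 0 (|z₀| + 1)) := by
    refine continuousOn_tsum (fun k => by fun_prop) (summable_pow_div_Gamma hα hβ (|z₀| + 1))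
      fun k z hz => ?_
    have hG := Gamma_natCast_mul_add_pos hα.le hβ k
    have hz' : ‖z‖ ≤ |z₀| + 1 := (mem_ball_zero_iff.1 hz).le
    rw [norm_div, norm_pow, Real.norm_of_nonneg hG.le]
    gcongr
  exact hcont.continuousAt (Metric.isOpen_ball.mem_nhds (by simp))

lemma mittagLeffler_zero : mittagLeffler α β 0 = 1 / Real.Gamma β := by
  rw [mittagLeffler, tsum_eq_single 0 fun k hk => by simp [hk]]
  simp

lemma mittagLeffler_eq_add_mul (hα : 0 < α) (hβ : 0 < β) (z : ℝ) :
    mittagLeffler α β z = 1 / Real.Gamma β + z * mittagLeffler α (α + β) z := by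
  have hterm (k : ℕ) : z ^ (k + 1) / Real.Gamma ((k + 1 : ℕ) * α + β)
      = z * (z ^ k / Real.Gamma (k * α + (α + β))) := by
    rw [pow_succ', mul_div_assoc]; push_cast; ring_nf
  rw [mittagLeffler, (summable_pow_div_Gamma hα hβ z).tsum_eq_zero_add, mittagLeffler,
    ← tsum_mul_left, tsum_congr hterm]
  simp

lemma integral_rpow_mul_sub_rpow {γ t : ℝ} (hβ : 0 < β) (hγ : 0 < γ) (ht : 0 < t) :
    ∫ s in (0 : ℝ)..t, s ^ (β - 1) * (t - s) ^ (γ - 1)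
      = t ^ (β + γ - 1) * (Real.Gamma β * Real.Gamma γ / Real.Gamma (β + γ)) := by
  have hbeta := Complex.betaIntegral_scaled (β : ℂ) (γ : ℂ) ht
  rw [Complex.betaIntegral_eq_Gamma_mul_div _ _ (by simpa) (by simpa)] at hbeta
  apply Complex.ofReal_injective
  rw [← intervalIntegral.integral_ofReal]
  push_cast [Complex.ofReal_cpow ht.le, ← Complex.Gamma_ofReal]
  rw [← hbeta]
  refine intervalIntegral.integral_congr fun s hs => ?_
  rw [uIcc_of_le ht.le] at hs
  push_cast [Complex.ofReal_cpow hs.1, Complex.ofReal_cpow (sub_nonneg.2 hs.2)]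
  rfl

lemma intervalIntegrable_rpow_mul_sub_rpow {γ t : ℝ} (hβ : 0 < β) (hγ : 0 < γ) (ht : 0 < t) :
    IntervalIntegrable (fun s => s ^ (β - 1) * (t - s) ^ (γ - 1)) volume 0 t := by
  -- the integral is nonzero, whereas a non-integrable function has the junk integral `0`
  by_contra hundef
  have hzero := intervalIntegral.integral_undef hundef
  rw [integral_rpow_mul_sub_rpow hβ hγ ht] at hzero
  have := Real.Gamma_pos_of_pos hβ
  have := Real.Gamma_pos_of_pos hγ
  have := Real.Gamma_pos_of_pos (add_pos hβ hγ)
  exact (by positivity : 0 < t ^ (β + γ - 1)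
    * (Real.Gamma β * Real.Gamma γ / Real.Gamma (β + γ))).ne' hzero

lemma integral_pow_div_Gamma_mul {γ t : ℝ} (hα : 0 < α) (hβ : 0 < β) (hγ : 0 < γ) (ht : 0 < t)
    (z : ℝ) (k : ℕ) :
    ∫ s in (0 : ℝ)..t, z ^ k / Real.Gamma (k * α + β) * (s ^ (k * α + β - 1) * (t - s) ^ (γ - 1))
      = Real.Gamma γ * t ^ (β + γ - 1)
        * ((z * t ^ α) ^ k / Real.Gamma (k * α + (β + γ))) := by
  have hpow : t ^ (k * α + β + γ - 1) = t ^ (β + γ - 1) * (t ^ α) ^ k := by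
    rw [← Real.rpow_natCast, ← Real.rpow_mul ht.le, ← Real.rpow_add ht]
    ring_nf
  have hG := (Gamma_natCast_mul_add_pos hα.le hβ k).ne'
  rw [intervalIntegral.integral_const_mul, integral_rpow_mul_sub_rpow (by positivity) hγ ht, hpow,
    add_assoc (k * α), mul_pow]
  field_simp

lemma integral_rpow_mul_sub_rpow_mul_mittagLeffler {γ t : ℝ} (hα : 0 < α) (hβ : 0 < β)
    (hγ : 0 < γ) (ht : 0 < t) (z : ℝ) :
    ∫ s in (0 : ℝ)..t, s ^ (β - 1) * (t - s) ^ (γ - 1) * mittagLeffler α β (z * s ^ α)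
      = Real.Gamma γ * t ^ (β + γ - 1) * mittagLeffler α (β + γ) (z * t ^ α) := by
  set F : ℝ → ℕ → ℝ → ℝ := fun z k s =>
    z ^ k / Real.Gamma (k * α + β) * (s ^ (k * α + β - 1) * (t - s) ^ (γ - 1))
  have integral_F (z : ℝ) (k : ℕ) : ∫ s in Ioc 0 t, F z k s = Real.Gamma γ * t ^ (β + γ - 1)
      * ((z * t ^ α) ^ k / Real.Gamma (k * α + (β + γ))) := by
    rw [← intervalIntegral.integral_of_le ht.le]
    exact integral_pow_div_Gamma_mul hα hβ hγ ht z k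
  have norm_F (k : ℕ) : ∀ s ∈ Ioc 0 t, ‖F z k s‖ = F |z| k s := fun s hs => by
    rw [norm_mul, norm_div, norm_pow, Real.norm_of_nonneg (Gamma_natCast_mul_add_pos hα.le hβ k).le,
      Real.norm_of_nonneg (mul_nonneg (Real.rpow_nonneg hs.1.le _)
        (Real.rpow_nonneg (sub_nonneg.2 hs.2) _)), Real.norm_eq_abs]
  have integrable_F (k : ℕ) : IntegrableOn (F z k) (Ioc 0 t) :=
    (intervalIntegrable_rpow_mul_sub_rpow (by positivity) hγ ht).1.const_mul _
  have tsum_F : ∀ s ∈ Ioc 0 t,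
      ∑' k, F z k s = s ^ (β - 1) * (t - s) ^ (γ - 1) * mittagLeffler α β (z * s ^ α) := by
    intro s hs
    rw [mittagLeffler, ← tsum_mul_left]
    refine tsum_congr fun k => ?_
    have hpow : s ^ (k * α + β - 1) = s ^ (β - 1) * (s ^ α) ^ k := by
      rw [← Real.rpow_natCast, ← Real.rpow_mul hs.1.le, ← Real.rpow_add hs.1]
      ring_nf
    simp only [F, hpow]
    ring
  have hsum := hasSum_integral_of_summable_integral_norm integrable_F <| by
    simp_rw [setIntegral_congr_fun measurableSet_Ioc (norm_F _), integral_F]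
    exact (summable_pow_div_Gamma hα (add_pos hβ hγ) _).mul_left _
  rw [intervalIntegral.integral_of_le ht.le, ← setIntegral_congr_fun measurableSet_Ioc tsum_F,
    ← hsum.tsum_eq, tsum_congr (integral_F z), tsum_mul_left, mittagLeffler]

/-- The Volterra equation satisfied by `t ↦ t ^ (α - 1) * E_{α,α}(-t ^ α)`. -/
lemma integral_rpow_mul_sub_rpow_mul_mittagLeffler_neg_rpow {t : ℝ} (hα : 0 < α) (ht : 0 < t) :
    ∫ s in (0 : ℝ)..t, s ^ (α - 1) * (t - s) ^ (α - 1) * mittagLeffler α α (-s ^ α)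
      = t ^ (α - 1) * (1 - Real.Gamma α * mittagLeffler α α (-t ^ α)) := by
  have hvolterra := integral_rpow_mul_sub_rpow_mul_mittagLeffler hα hα hα ht (-1)
  simp only [neg_one_mul] at hvolterra
  have hpow : t ^ (α + α - 1) = t ^ (α - 1) * t ^ α := by
    rw [← Real.rpow_add ht]; ring_nf
  have hΓ := (Real.Gamma_pos_of_pos hα).ne'
  rw [hvolterra, mittagLeffler_eq_add_mul hα hα, hpow]
  field_simp
  ring

lemma continuous_mittagLeffler_mul_rpow (hα : 0 < α) (hβ : 0 < β) (z : ℝ) :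
    Continuous fun t : ℝ => mittagLeffler α β (z * t ^ α) :=
  (continuous_mittagLeffler hα hβ).comp
    (continuous_const.mul (Real.continuous_rpow_const hα.le))

lemma continuous_mittagLeffler_neg_rpow (hα : 0 < α) (hβ : 0 < β) :
    Continuous fun t : ℝ => mittagLeffler α β (-t ^ α) := by
  simpa only [neg_one_mul] using continuous_mittagLeffler_mul_rpow hα hβ (-1)

end MittagLeffler

section Positivity

lemma exists_forall_Ico_pos_of_nonpos {e : ℝ → ℝ} {a b : ℝ} (hab : a ≤ b)
    (he : ContinuousOn e (Icc a b)) (hea : 0 < e a) (heb : e b ≤ 0) :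
    ∃ t ∈ Ioc a b, e t ≤ 0 ∧ ∀ s ∈ Ico a t, 0 < e s := by
  have hclosed : IsClosed (Icc a b ∩ e ⁻¹' Iic 0) :=
    he.preimage_isClosed_of_isClosed isClosed_Icc isClosed_Iic
  obtain ⟨t, ⟨htab, het⟩, hleast⟩ := (isCompact_Icc.of_isClosed_subset hclosed
    inter_subset_left).exists_isLeast ⟨b, right_mem_Icc.2 hab, heb⟩
  have hat : a ≠ t := by rintro rfl; exact hea.not_ge het
  refine ⟨t, ⟨lt_of_le_of_ne htab.1 hat, htab.2⟩, het, fun s hs => ?_⟩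
  by_contra! hes
  exact (hleast ⟨⟨hs.1, hs.2.le.trans htab.2⟩, hes⟩).not_gt hs.2

lemma exists_intervalIntegral_lt {w : ℝ → ℝ} {a b ε : ℝ} (hab : a < b)
    (hw : IntervalIntegrable w volume a b) (hε : 0 < ε) :
    ∃ c ∈ Ioo a b, ∫ s in c..b, w s < ε := by
  have hcont : ContinuousOn (fun c => -∫ s in b..c, w s) (uIcc a b) :=
    (intervalIntegral.continuousOn_primitive_interval' hw right_mem_uIcc).neg
  have hsmall : ∀ᶠ c in 𝓝[uIcc a b] b, -∫ s in b..c, w s < ε :=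
    (hcont b right_mem_uIcc).eventually (gt_mem_nhds (by simpa))
  have hsub : Ioo a b ⊆ uIcc a b := Ioo_subset_Icc_self.trans Icc_subset_uIcc
  have hsmall' := hsmall.filter_mono (nhdsWithin_mono b hsub)
  rw [nhdsWithin_Ioo_eq_nhdsLT hab] at hsmall'
  obtain ⟨c, hc, hcab⟩ := (hsmall'.and (Ioo_mem_nhdsLT hab)).exists
  exact ⟨c, hcab, by rwa [intervalIntegral.integral_symm]⟩

lemma exists_Ioo_nonpos_of_mul_le_integral {w e : ℝ → ℝ} {a b C : ℝ} (hab : a < b) (hC : 0 < C)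
    (hw : IntervalIntegrable w volume a b) (hw0 : ∀ s ∈ Ioc a b, 0 ≤ w s)
    (he : ContinuousOn e (Icc a b)) (heb : e b ≤ 0)
    (hle : ∀ t ∈ Ioo a b, C * e t ≤ ∫ s in t..b, w s * e s) :
    ∃ t ∈ Ioo a b, e t ≤ 0 := by
  -- compare both sides at a maximum of `e` on an interval `[c, b]` where `w` has mass below `C`
  by_contra! hpos
  obtain ⟨c, hc, hwc⟩ := exists_intervalIntegral_lt hab hw hC
  have hcb : Icc c b ⊆ Icc a b := Icc_subset_Icc_left hc.1.le
  obtain ⟨t, ht, hmax⟩ :=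
    isCompact_Icc.exists_isMaxOn (nonempty_Icc.2 hc.2.le) (he.mono hcb)
  have het : 0 < e t := (hpos c hc).trans_le (hmax (left_mem_Icc.2 hc.2.le))
  have htb : t < b := lt_of_le_of_ne ht.2 fun h => by rw [h] at het; exact het.not_ge heb
  have hat : a < t := hc.1.trans_le ht.1
  have integrable_w {r : ℝ} (har : a ≤ r) (hrb : r ≤ b) : IntervalIntegrable w volume r b :=
    hw.mono_set (by rw [uIcc_of_le hrb, uIcc_of_le hab.le]; exact Icc_subset_Icc_left har)
  have hwt := integrable_w hat.le htb.le
  have hwe : IntervalIntegrable (fun s => w s * e s) volume t b :=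
    hwt.mul_continuousOn (he.mono (by rw [uIcc_of_le htb.le]; exact Icc_subset_Icc_left hat.le))
  refine lt_irrefl (C * e t) ?_
  calc C * e t ≤ ∫ s in t..b, w s * e s := hle t ⟨hat, htb⟩
    _ ≤ ∫ s in t..b, w s * e t :=
        intervalIntegral.integral_mono_on_of_le_Ioo htb.le hwe (hwt.mul_const _) fun s hs =>
          mul_le_mul_of_nonneg_left (hmax ⟨ht.1.trans hs.1.le, hs.2.le⟩)
            (hw0 s ⟨hat.trans hs.1, hs.2.le⟩)
    _ = (∫ s in t..b, w s) * e t := intervalIntegral.integral_mul_const _ _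
    _ ≤ (∫ s in c..b, w s) * e t := by
        gcongr
        refine intervalIntegral.integral_mono_interval ht.1 htb.le le_rfl ?_
          (integrable_w hc.1.le hc.2.le)
        filter_upwards [ae_restrict_mem measurableSet_Ioc] with s hs
        exact hw0 s ⟨hc.1.trans hs.1, hs.2⟩
    _ < C * e t := by gcongr

lemma sub_rpow_le_div_rpow_mul_sub_rpow {p s t r : ℝ} (hp : p ≤ 0) (hs : 0 ≤ s) (hst : s < t)
    (htr : t ≤ r) : (r - s) ^ p ≤ (r / t) ^ p * (t - s) ^ p := by
  have ht : 0 < t := hs.trans_lt hst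
  have hr : 0 < r := ht.trans_le htr
  rw [← Real.mul_rpow (by positivity) (by linarith)]
  refine Real.rpow_le_rpow_of_nonpos (mul_pos (by positivity) (by linarith)) ?_ hp
  rw [div_mul_eq_mul_div, div_le_iff₀ ht]
  nlinarith

variable {α : ℝ}

lemma Gamma_mul_rpow_mul_mittagLeffler_le_integral {t r : ℝ} (hα : 0 < α) (hα1 : α ≤ 1)
    (ht : t ∈ Ioo 0 r) (hpos : ∀ s ∈ Ico 0 r, 0 < mittagLeffler α α (-s ^ α))
    (hr : mittagLeffler α α (-r ^ α) ≤ 0) :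
    Real.Gamma α * r ^ (α - 1) * mittagLeffler α α (-t ^ α)
      ≤ ∫ s in t..r, s ^ (α - 1) * (r - s) ^ (α - 1) * mittagLeffler α α (-s ^ α) := by
  obtain ⟨ht0, htr⟩ := ht
  set e : ℝ → ℝ := fun s => mittagLeffler α α (-s ^ α)
  have hr0 : 0 < r := ht0.trans htr
  have hΓ := Real.Gamma_pos_of_pos hα
  have integrable_e {x : ℝ} (hx : 0 < x) :
      IntervalIntegrable (fun s => s ^ (α - 1) * (x - s) ^ (α - 1) * e s) volume 0 x :=
    (intervalIntegrable_rpow_mul_sub_rpow hα hα hx).mul_continuousOn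
      (continuous_mittagLeffler_neg_rpow hα hα).continuousOn
  have htmem : t ∈ uIcc 0 r := by rw [uIcc_of_le hr0.le]; exact ⟨ht0.le, htr.le⟩
  have hint_left := (integrable_e hr0).mono_set (uIcc_subset_uIcc_left htmem)
  have hint_right := (integrable_e hr0).mono_set (uIcc_subset_uIcc_right htmem)
  have hleft : ∫ s in (0 : ℝ)..t, s ^ (α - 1) * (r - s) ^ (α - 1) * e s
      ≤ r ^ (α - 1) * (1 - Real.Gamma α * e t) := by
    calc ∫ s in (0 : ℝ)..t, s ^ (α - 1) * (r - s) ^ (α - 1) * e s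
        ≤ ∫ s in (0 : ℝ)..t, (r / t) ^ (α - 1) * (s ^ (α - 1) * (t - s) ^ (α - 1) * e s) := by
          refine intervalIntegral.integral_mono_on_of_le_Ioo ht0.le hint_left
            ((integrable_e ht0).const_mul _) fun s hs => ?_
          have hlog := sub_rpow_le_div_rpow_mul_sub_rpow (sub_nonpos.2 hα1) hs.1.le hs.2 htr.le
          have hfac : 0 ≤ s ^ (α - 1) * e s :=
            mul_nonneg (Real.rpow_nonneg hs.1.le _) (hpos s ⟨hs.1.le, hs.2.trans htr⟩).le
          linarith [mul_le_mul_of_nonneg_right hlog hfac]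
      _ = r ^ (α - 1) * (1 - Real.Gamma α * e t) := by
          rw [intervalIntegral.integral_const_mul,
            integral_rpow_mul_sub_rpow_mul_mittagLeffler_neg_rpow hα ht0, ← mul_assoc,
            ← Real.mul_rpow (by positivity) ht0.le, div_mul_cancel₀ _ ht0.ne']
  have htotal : r ^ (α - 1) ≤ ∫ s in (0 : ℝ)..r, s ^ (α - 1) * (r - s) ^ (α - 1) * e s := by
    rw [integral_rpow_mul_sub_rpow_mul_mittagLeffler_neg_rpow hα hr0]
    have := mul_nonpos_of_nonneg_of_nonpos hΓ.le hr
    exact le_mul_of_one_le_right (by positivity) (by linarith)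
  linarith [intervalIntegral.integral_add_adjacent_intervals hint_left hint_right]

lemma mittagLeffler_neg_rpow_pos (hα : 0 < α) (hα1 : α ≤ 1) {t : ℝ} (ht : 0 ≤ t) :
    0 < mittagLeffler α α (-t ^ α) := by
  have hΓ := Real.Gamma_pos_of_pos hα
  have hcont := continuous_mittagLeffler_neg_rpow hα hα
  by_contra! hneg
  obtain ⟨r, hr, her, hpos⟩ := exists_forall_Ico_pos_of_nonpos ht hcont.continuousOn
    (by simpa [Real.zero_rpow hα.ne', mittagLeffler_zero]) hneg
  obtain ⟨s, hs, hes⟩ := exists_Ioo_nonpos_of_mul_le_integral hr.1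
    (mul_pos hΓ (Real.rpow_pos_of_pos hr.1 (α - 1)))
    (intervalIntegrable_rpow_mul_sub_rpow hα hα hr.1)
    (fun s hs => mul_nonneg (Real.rpow_nonneg hs.1.le _)
      (Real.rpow_nonneg (sub_nonneg.2 hs.2) _))
    hcont.continuousOn her
    (fun s hs => Gamma_mul_rpow_mul_mittagLeffler_le_integral hα hα1 hs hpos her)
  exact (hpos s ⟨hs.1.le, hs.2⟩).not_ge hes

lemma mittagLeffler_neg_rpow_le (hα : 0 < α) (hα1 : α ≤ 1) {t : ℝ} (ht : 0 ≤ t) :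
    mittagLeffler α α (-t ^ α) ≤ 1 / Real.Gamma α := by
  rcases ht.eq_or_lt with rfl | ht
  · simp [Real.zero_rpow hα.ne', mittagLeffler_zero]
  have hnonneg : 0 ≤ ∫ s in (0 : ℝ)..t,
      s ^ (α - 1) * (t - s) ^ (α - 1) * mittagLeffler α α (-s ^ α) :=
    intervalIntegral.integral_nonneg ht.le fun s hs =>
      mul_nonneg (mul_nonneg (Real.rpow_nonneg hs.1 _) (Real.rpow_nonneg (sub_nonneg.2 hs.2) _))
        (mittagLeffler_neg_rpow_pos hα hα1 hs.1).le
  rw [integral_rpow_mul_sub_rpow_mul_mittagLeffler_neg_rpow hα ht] at hnonneg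
  have hdiff := nonneg_of_mul_nonneg_right hnonneg (by positivity)
  rw [le_div_iff₀' (Real.Gamma_pos_of_pos hα)]
  linarith

lemma mittagLeffler_neg_pos (hα : 0 < α) (hα1 : α ≤ 1) {x : ℝ} (hx : 0 ≤ x) :
    0 < mittagLeffler α α (-x) := by
  simpa only [Real.rpow_inv_rpow hx hα.ne'] using
    mittagLeffler_neg_rpow_pos hα hα1 (Real.rpow_nonneg hx α⁻¹)

lemma mittagLeffler_neg_le (hα : 0 < α) (hα1 : α ≤ 1) {x : ℝ} (hx : 0 ≤ x) :
    mittagLeffler α α (-x) ≤ 1 / Real.Gamma α := by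
  simpa only [Real.rpow_inv_rpow hx hα.ne'] using
    mittagLeffler_neg_rpow_le hα hα1 (Real.rpow_nonneg hx α⁻¹)

end Positivity

/-! ### The fractional kernel and its weights -/

lemma measurePreserving_const_sub_restrict_Ioo (T : ℝ) :
    MeasurePreserving (fun τ => T - τ) (volume.restrict (Ioo 0 T))
      (volume.restrict (Ioo 0 T)) := by
  simpa using (volume.measurePreserving_sub_left T).restrict_preimage
    (measurableSet_Ioo (a := 0) (b := T))

lemma not_ae_eq_zero_of_ae_le {X : Type*} [MeasurableSpace X] {μ : Measure X} {F : X → ℝ} {c : ℝ}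
    (hμ : μ ≠ 0) (hc : 0 < c) (hF : ∀ᵐ x ∂μ, c ≤ F x) : ¬ F =ᵐ[μ] 0 := fun hzero => by
  have := ae_neBot.2 hμ
  obtain ⟨x, hx, hx0⟩ := (hF.and hzero).exists
  exact (hc.trans_le hx).ne' hx0

section Kernel

variable {α T μ ν τ : ℝ} {h : ℝ → ℝ}

lemma kernel_pos (hα : 0 < α) (hα1 : α ≤ 1) (hμ : 0 ≤ μ) (hτ : 0 < τ) : 0 < kernel α μ τ := by
  rw [kernel, neg_mul]
  exact mul_pos (by positivity) (mittagLeffler_neg_pos hα hα1 (by positivity))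

lemma kernel_le (hα : 0 < α) (hα1 : α ≤ 1) (hμ : 0 ≤ μ) (hτ : 0 ≤ τ) :
    kernel α μ τ ≤ τ ^ (α - 1) / Real.Gamma α := by
  rw [kernel, neg_mul, div_eq_mul_one_div]
  exact mul_le_mul_of_nonneg_left (mittagLeffler_neg_le hα hα1 (by positivity)) (by positivity)

lemma norm_kernel_le (hα : 0 < α) (hα1 : α ≤ 1) (hμ : 0 ≤ μ) (hτ : 0 < τ) :
    ‖kernel α μ τ‖ ≤ τ ^ (α - 1) / Real.Gamma α := by
  rw [Real.norm_of_nonneg (kernel_pos hα hα1 hμ hτ).le]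
  exact kernel_le hα hα1 hμ hτ.le

lemma measurable_kernel (hα : 0 < α) (μ : ℝ) : Measurable (kernel α μ) :=
  (measurable_id.pow_const _).mul (continuous_mittagLeffler_mul_rpow hα hα (-μ)).measurable

lemma memLp_rpow_sub_one_div (hα : 1 / 2 < α) (T c : ℝ) :
    MemLp (fun τ : ℝ => τ ^ (α - 1) / c) 2 (volume.restrict (Ioo 0 T)) := by
  have hmeas : AEStronglyMeasurable (fun τ : ℝ => τ ^ (α - 1)) (volume.restrict (Ioo 0 T)) :=
    (measurable_id.pow_const _).aestronglyMeasurable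
  have hint : IntegrableOn (fun τ : ℝ => τ ^ (2 * α - 2)) (Ioo 0 T) :=
    (intervalIntegral.intervalIntegrable_rpow' (by linarith)).1.mono_set Ioo_subset_Ioc_self
  simp_rw [div_eq_mul_inv]
  refine MemLp.mul_const ((memLp_two_iff_integrable_sq hmeas).2 ?_) _
  refine hint.congr_fun (fun τ hτ => ?_) measurableSet_Ioo
  dsimp only
  rw [← Real.rpow_mul_natCast hτ.1.le]
  push_cast
  ring_nf

lemma memLp_kernel (hα : 1 / 2 < α) (hα1 : α ≤ 1) (hμ : 0 ≤ μ) (T : ℝ) :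
    MemLp (kernel α μ) 2 (volume.restrict (Ioo 0 T)) := by
  have hα0 : 0 < α := by linarith
  refine (memLp_rpow_sub_one_div hα T (Real.Gamma α)).of_le
    (measurable_kernel hα0 μ).aestronglyMeasurable ?_
  filter_upwards [ae_restrict_mem measurableSet_Ioo] with τ hτ
  exact (norm_kernel_le hα0 hα1 hμ hτ.1).trans (le_abs_self _)

lemma covWeight_eq (hT : 0 ≤ T) (μ ν : ℝ) :
    covWeight α T μ ν = ∫ τ in Ioo 0 T, kernel α μ τ * kernel α ν τ := by
  rw [covWeight, intervalIntegral.integral_of_le hT, integral_Ioc_eq_integral_Ioo]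
  refine setIntegral_congr_fun measurableSet_Ioo fun τ hτ => ?_
  have hpow : τ ^ (2 * α - 2) = τ ^ (α - 1) * τ ^ (α - 1) := by
    rw [← Real.rpow_add hτ.1]; ring_nf
  simp only [kernel, hpow]
  ring

lemma covWeight_pos (hα : 1 / 2 < α) (hα1 : α ≤ 1) (hT : 0 < T) (hμ : 0 ≤ μ) (hν : 0 ≤ ν) :
    0 < covWeight α T μ ν := by
  have hα0 : 0 < α := by linarith
  rw [covWeight_eq hT.le, ← integral_Ioc_eq_integral_Ioo, ← intervalIntegral.integral_of_le hT.le]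
  refine intervalIntegral.intervalIntegral_pos_of_pos_on
    ((intervalIntegrable_iff_integrableOn_Ioo_of_le hT.le).2
      ((memLp_kernel hα hα1 hμ T).integrable_mul (memLp_kernel hα hα1 hν T)))
    (fun τ hτ => mul_pos (kernel_pos hα0 hα1 hμ hτ.1) (kernel_pos hα0 hα1 hν hτ.1)) hT

lemma covWeight_self_le (hα : 1 / 2 < α) (hα1 : α ≤ 1) (hT : 0 ≤ T) (hμ : 0 ≤ μ) :
    covWeight α T μ μ ≤ ∫ τ in Ioo 0 T, (τ ^ (α - 1) / Real.Gamma α) ^ 2 := by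
  have hα0 : 0 < α := by linarith
  have hk := memLp_kernel hα hα1 hμ T
  rw [covWeight_eq hT]
  refine setIntegral_mono_on (hk.integrable_mul hk)
    (memLp_rpow_sub_one_div hα T _).integrable_sq measurableSet_Ioo fun τ hτ => ?_
  rw [← sq]
  exact pow_le_pow_left₀ (kernel_pos hα0 hα1 hμ hτ.1).le (kernel_le hα0 hα1 hμ hτ.1.le) 2

lemma meanWeight_eq (hT : 0 ≤ T) (μ : ℝ) (h : ℝ → ℝ) :
    meanWeight α T μ h = ∫ τ in Ioo 0 T, kernel α μ τ * h (T - τ) := by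
  rw [meanWeight, intervalIntegral.integral_of_le hT, integral_Ioc_eq_integral_Ioo]
  rfl

lemma integral_kernel_sub_mul (T μ : ℝ) (h : ℝ → ℝ) :
    ∫ τ in (0 : ℝ)..T, kernel α μ (T - τ) * h τ = meanWeight α T μ h := by
  simpa [meanWeight, kernel] using intervalIntegral.integral_comp_sub_left (a := 0) (b := T)
    (fun τ => kernel α μ τ * h (T - τ)) T

lemma meanWeight_pos (hα : 1 / 2 < α) (hα1 : α ≤ 1) (hT : 0 ≤ T) (hμ : 0 ≤ μ)
    (hh : MemLp h 2 (volume.restrict (Ioo 0 T))) (hh0 : 0 ≤ᵐ[volume.restrict (Ioo 0 T)] h)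
    (hne : ¬ h =ᵐ[volume.restrict (Ioo 0 T)] 0) : 0 < meanWeight α T μ h := by
  have hrefl := measurePreserving_const_sub_restrict_Ioo T
  have hint : Integrable (fun τ => kernel α μ τ * h (T - τ)) (volume.restrict (Ioo 0 T)) :=
    (memLp_kernel hα hα1 hμ T).integrable_mul (hh.comp_measurePreserving hrefl)
  have hk : ∀ᵐ τ ∂(volume.restrict (Ioo 0 T)), 0 < kernel α μ τ := by
    filter_upwards [ae_restrict_mem measurableSet_Ioo] with τ hτ
    exact kernel_pos (by linarith) hα1 hμ hτ.1
  have hnonneg : 0 ≤ᵐ[volume.restrict (Ioo 0 T)] fun τ => kernel α μ τ * h (T - τ) := by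
    filter_upwards [hk, hrefl.quasiMeasurePreserving.ae hh0] with τ hkτ hhτ
    exact mul_nonneg hkτ.le hhτ
  rw [meanWeight_eq hT]
  refine (integral_nonneg_of_ae hnonneg).lt_of_ne' fun hzero => hne ?_
  have hvanish : ∀ᵐ τ ∂(volume.restrict (Ioo 0 T)), h (T - τ) = 0 := by
    filter_upwards [hk, (integral_eq_zero_iff_of_nonneg_ae hnonneg hint).1 hzero] with τ hkτ hτ
    exact (mul_eq_zero.1 hτ).resolve_left hkτ.ne'
  filter_upwards [hrefl.quasiMeasurePreserving.ae hvanish] with τ hτ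
  simpa using hτ

lemma norm_meanWeight_le (hα : 1 / 2 < α) (hα1 : α ≤ 1) (hT : 0 ≤ T) (hμ : 0 ≤ μ)
    (hh : MemLp h 2 (volume.restrict (Ioo 0 T))) :
    ‖meanWeight α T μ h‖ ≤ ∫ τ in Ioo 0 T, ‖τ ^ (α - 1) / Real.Gamma α * h (T - τ)‖ := by
  have hint : Integrable (fun τ => τ ^ (α - 1) / Real.Gamma α * h (T - τ))
      (volume.restrict (Ioo 0 T)) :=
    (memLp_rpow_sub_one_div hα T _).integrable_mul
      (hh.comp_measurePreserving (measurePreserving_const_sub_restrict_Ioo T))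
  rw [meanWeight_eq hT]
  refine norm_integral_le_of_norm_le hint.norm ?_
  filter_upwards [ae_restrict_mem measurableSet_Ioo] with τ hτ
  rw [norm_mul, norm_mul]
  gcongr
  exact (norm_kernel_le (by linarith) hα1 hμ hτ.1).trans (le_abs_self _)

lemma memLp_kernel_sub (hα : 1 / 2 < α) (hα1 : α ≤ 1) (hμ : 0 ≤ μ) (T : ℝ) :
    MemLp (fun τ => kernel α μ (T - τ)) 2 (volume.restrict (Ioc 0 T)) := by
  rw [← restrict_Ioo_eq_restrict_Ioc]
  exact (memLp_kernel hα hα1 hμ T).comp_measurePreserving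
    (measurePreserving_const_sub_restrict_Ioo T)

lemma integral_kernel_sub_mul_kernel_sub (hT : 0 ≤ T) (μ ν : ℝ) :
    ∫ τ in Ioc 0 T, kernel α μ (T - τ) * kernel α ν (T - τ) = covWeight α T μ ν := by
  have hrefl := intervalIntegral.integral_comp_sub_left (a := 0) (b := T)
    (fun τ => kernel α μ τ * kernel α ν τ) T
  rw [covWeight_eq hT, ← integral_Ioc_eq_integral_Ioo, ← intervalIntegral.integral_of_le hT,
    ← intervalIntegral.integral_of_le hT, hrefl]
  simp

end Kernel

/-! ### Step functions in `L²(0, t)` -/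

lemma ae_eq_zero_of_forall_intervalIntegral_eq_zero {F : ℝ → ℝ} {a b : ℝ}
    (hF : IntervalIntegrable F volume a b) (hzero : ∀ x ∈ Ioo a b, ∫ y in a..x, F y = 0) :
    F =ᵐ[volume.restrict (Ioo a b)] 0 := by
  rw [EventuallyEq, ae_restrict_iff' measurableSet_Ioo]
  filter_upwards [hF.ae_hasDerivAt_integral] with x hderiv hx
  have hab : Ioo a b ⊆ uIcc a b := Ioo_subset_Icc_self.trans Icc_subset_uIcc
  refine (hderiv (hab hx) a left_mem_uIcc).unique
    ((hasDerivAt_const x (0 : ℝ)).congr_of_eventuallyEq ?_)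
  filter_upwards [Ioo_mem_nhds hx.1 hx.2] with y hy using hzero y hy

lemma inner_toLp_eq_integral_mul {X : Type*} [MeasurableSpace X] {μ : Measure X} {F G : X → ℝ}
    (hF : MemLp F 2 μ) (hG : MemLp G 2 μ) :
    inner ℝ hF.toLp hG.toLp = ∫ x, F x * G x ∂μ := by
  rw [L2.inner_def]
  refine integral_congr_ae ?_
  filter_upwards [hF.coeFn_toLp, hG.coeFn_toLp] with x hFx hGx
  simp [hFx, hGx, mul_comm]

namespace StepFn

variable {t : ℝ}

lemma memLp_eval (s : StepFn t) {μ : Measure ℝ} [IsFiniteMeasure μ] : MemLp s.eval 2 μ :=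
  memLp_finsetSum _ fun i _ => (memLp_const (s.c i)).indicator measurableSet_Ioc

/-- The sum of two step functions, the list of intervals of `r` being appended to that of `s`. -/
noncomputable def add (s r : StepFn t) : StepFn t where
  m := s.m + r.m
  c := Fin.append s.c r.c
  a := Fin.append s.a r.a
  b := Fin.append s.b r.b
  a_le_b := Fin.addCases (by simpa using s.a_le_b) (by simpa using r.a_le_b)
  b_le := Fin.addCases (by simpa using s.b_le) (by simpa using r.b_le)

/-- The multiple `x • s` of a step function. -/
noncomputable def smul (x : ℝ) (s : StepFn t) : StepFn t where
  m := s.m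
  c i := x * s.c i
  a := s.a
  b := s.b
  a_le_b := s.a_le_b
  b_le := s.b_le

/-- The zero step function, with an empty list of intervals. -/
noncomputable def zero (t : ℝ) : StepFn t where
  m := 0
  c := Fin.elim0
  a := Fin.elim0
  b := Fin.elim0
  a_le_b i := i.elim0
  b_le i := i.elim0

/-- The indicator function of `(0, b]`. -/
noncomputable def initial (b : ℝ≥0) (hb : (b : ℝ) ≤ t) : StepFn t where
  m := 1
  c _ := 1
  a _ := 0
  b _ := b
  a_le_b _ := zero_le
  b_le _ := hb

lemma eval_add (s r : StepFn t) : (s.add r).eval = s.eval + r.eval :=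
  funext fun τ => (Fin.sum_univ_add _).trans (by simp [add, eval])

lemma eval_smul (x : ℝ) (s : StepFn t) : (s.smul x).eval = x • s.eval := by
  ext τ
  simp only [eval, Pi.smul_apply, smul_eq_mul, Finset.mul_sum, indicator_apply, mul_ite, mul_zero]
  rfl

lemma eval_zero : (zero t).eval = 0 :=
  funext fun _ => Fin.sum_univ_zero _

lemma eval_initial (b : ℝ≥0) (hb : (b : ℝ) ≤ t) :
    (initial b hb).eval = (Ioc 0 (b : ℝ)).indicator 1 :=
  funext fun _ => (Fin.sum_univ_one _).trans rfl

/-- The class of a step function in `L²(0, t)`. -/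
noncomputable def toL2 (s : StepFn t) : Lp ℝ 2 (volume.restrict (Ioc 0 t)) :=
  s.memLp_eval.toLp

lemma toL2_add (s r : StepFn t) : (s.add r).toL2 = s.toL2 + r.toL2 :=
  (MemLp.toLp_congr _ (s.memLp_eval.add r.memLp_eval) (.of_eq (s.eval_add r))).trans
    (MemLp.toLp_add _ _)

lemma toL2_smul (x : ℝ) (s : StepFn t) : (s.smul x).toL2 = x • s.toL2 :=
  (MemLp.toLp_congr _ (s.memLp_eval.const_smul x) (.of_eq (s.eval_smul x))).trans
    (MemLp.toLp_const_smul _ _)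

lemma toL2_zero : (zero t).toL2 = 0 :=
  Lp.eq_zero_iff_ae_eq_zero.2 ((zero t).memLp_eval.coeFn_toLp.trans (.of_eq eval_zero))

/-- The subspace of `L²(0, t)` formed by the step functions. -/
noncomputable def submodule (t : ℝ) : Submodule ℝ (Lp ℝ 2 (volume.restrict (Ioc 0 t))) where
  carrier := range toL2
  add_mem' := by
    rintro _ _ ⟨s, rfl⟩ ⟨r, rfl⟩
    exact ⟨s.add r, s.toL2_add r⟩
  zero_mem' := ⟨zero t, toL2_zero⟩
  smul_mem' := by
    rintro x _ ⟨s, rfl⟩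
    exact ⟨s.smul x, s.toL2_smul x⟩

lemma inner_toL2_initial {b : ℝ≥0} (hb : (b : ℝ) ≤ t) (F : Lp ℝ 2 (volume.restrict (Ioc 0 t))) :
    inner ℝ (initial b hb).toL2 F = ∫ x in (0 : ℝ)..b, F x := by
  have hinner : inner ℝ (initial b hb).toL2 F = _ :=
    (congrArg (inner ℝ _) (Lp.toLp_coeFn F (Lp.memLp F)).symm).trans
      (inner_toLp_eq_integral_mul (initial b hb).memLp_eval (Lp.memLp F))
  simp only [hinner, eval_initial, ← indicator_mul_left, Pi.one_apply, one_mul]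
  rw [integral_indicator measurableSet_Ioc, Measure.restrict_restrict measurableSet_Ioc,
    inter_eq_self_of_subset_left (Ioc_subset_Ioc_right hb),
    intervalIntegral.integral_of_le b.coe_nonneg]

lemma topologicalClosure_submodule (ht : 0 ≤ t) : (submodule t).topologicalClosure = ⊤ := by
  rw [Submodule.topologicalClosure_eq_top_iff, Submodule.eq_bot_iff]
  intro F hF
  have hint : IntervalIntegrable F volume 0 t :=
    (intervalIntegrable_iff_integrableOn_Ioc_of_le ht).2 ((Lp.memLp F).integrable one_le_two)
  have hprim : ∀ x ∈ Ioo 0 t, ∫ y in (0 : ℝ)..x, F y = 0 := fun x hx =>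
    (inner_toL2_initial (b := ⟨x, hx.1.le⟩) hx.2.le F).symm.trans (hF _ ⟨_, rfl⟩)
  have hF0 := ae_eq_zero_of_forall_intervalIntegral_eq_zero hint hprim
  rw [restrict_Ioo_eq_restrict_Ioc] at hF0
  exact (Lp.eq_zero_iff_ae_eq_zero).2 hF0

lemma exists_tendsto_toL2 (ht : 0 ≤ t) (F : Lp ℝ 2 (volume.restrict (Ioc 0 t))) :
    ∃ s : ℕ → StepFn t, Tendsto (fun j => (s j).toL2) atTop (𝓝 F) := by
  have hF : F ∈ (submodule t).topologicalClosure := by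
    rw [topologicalClosure_submodule ht]
    trivial
  obtain ⟨x, hx, hlim⟩ := mem_closure_iff_seq_limit.1 hF
  choose s hs using hx
  exact ⟨s, by simpa only [hs] using hlim⟩

end StepFn

/-! ### The Wiener integral -/

section Wiener

variable {Ω : Type*} [MeasurableSpace Ω] {P : Measure Ω} {W : ℝ≥0 → Ω → ℝ} {t : ℝ}

lemma memLp_two_of_isPreBrownianReal (hW : IsPreBrownianReal W P) (x : ℝ≥0) : MemLp (W x) 2 P :=
  (hW.isGaussianProcess.hasGaussianLaw_eval x).memLp_two

lemma memLp_sub_of_isPreBrownianReal (hW : IsPreBrownianReal W P) (a b : ℝ≥0) :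
    MemLp (fun ω => W b ω - W a ω) 2 P :=
  (memLp_two_of_isPreBrownianReal hW b).sub (memLp_two_of_isPreBrownianReal hW a)

lemma integral_sub_of_isPreBrownianReal (hW : IsPreBrownianReal W P) (a b : ℝ≥0) :
    ∫ ω, (W b ω - W a ω) ∂P = 0 := by
  rw [integral_sub (hW.integrable_eval b) (hW.integrable_eval a), hW.integral_eval,
    hW.integral_eval, sub_zero]

lemma covariance_sub_sub_of_isPreBrownianReal (hW : IsPreBrownianReal W P) {a b a' b' : ℝ≥0}
    (hab : a ≤ b) (hab' : a' ≤ b') :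
    cov[fun ω => W b ω - W a ω, fun ω => W b' ω - W a' ω; P]
      = volume.real (Ioc (a : ℝ) b ∩ Ioc (a' : ℝ) b') := by
  have : IsProbabilityMeasure P := hW.isGaussianProcess.isProbabilityMeasure
  have hmem := memLp_two_of_isPreBrownianReal hW
  rw [covariance_fun_sub_fun_sub (hmem b) (hmem a) (hmem b') (hmem a'), Ioc_inter_Ioc,
    Real.volume_real_Ioc]
  simp only [hW.covariance_eval, NNReal.coe_min]
  rw [← NNReal.coe_le_coe] at hab hab'
  grind

lemma setIntegral_indicator_mul_indicator {X : Type*} [MeasurableSpace X] {μ : Measure X}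
    {A B S : Set X} (hA : MeasurableSet A) (hB : MeasurableSet B) (hAS : A ⊆ S) (c c' : ℝ) :
    ∫ x in S, A.indicator (fun _ => c) x * B.indicator (fun _ => c') x ∂μ
      = c * c' * μ.real (A ∩ B) := by
  have hAB := hA.inter hB
  simp only [← inter_indicator_mul (fun _ => c) (fun _ => c')]
  rw [integral_indicator hAB, Measure.restrict_restrict hAB,
    inter_eq_self_of_subset_left (inter_subset_left.trans hAS), setIntegral_const, smul_eq_mul,
    mul_comm]

namespace StepFn

lemma memLp_wiener (hW : IsPreBrownianReal W P) (s : StepFn t) : MemLp (s.wiener W) 2 P :=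
  memLp_finsetSum _ fun i _ => (memLp_sub_of_isPreBrownianReal hW (s.a i) (s.b i)).const_mul (s.c i)

lemma integral_wiener (hW : IsPreBrownianReal W P) (s : StepFn t) : ∫ ω, s.wiener W ω ∂P = 0 := by
  have : IsProbabilityMeasure P := hW.isGaussianProcess.isProbabilityMeasure
  simp only [wiener]
  rw [integral_finsetSum _ fun i _ =>
    ((memLp_sub_of_isPreBrownianReal hW _ _).integrable one_le_two).const_mul _]
  simp only [integral_const_mul, integral_sub_of_isPreBrownianReal hW, mul_zero,
    Finset.sum_const_zero]

lemma integral_eval_mul_eval (s r : StepFn t) :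
    ∫ τ in Ioc 0 t, s.eval τ * r.eval τ = ∑ i, ∑ j, s.c i * r.c j
      * volume.real (Ioc (s.a i : ℝ) (s.b i) ∩ Ioc (r.a j : ℝ) (r.b j)) := by
  have hmem (q : StepFn t) (i) : MemLp ((Ioc (q.a i : ℝ) (q.b i)).indicator fun _ => q.c i) 2
      (volume.restrict (Ioc 0 t)) :=
    (memLp_const _).indicator measurableSet_Ioc
  have hint (i j) : IntegrableOn (fun τ => (Ioc (s.a i : ℝ) (s.b i)).indicator (fun _ => s.c i) τ
      * (Ioc (r.a j : ℝ) (r.b j)).indicator (fun _ => r.c j) τ) (Ioc 0 t) :=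
    (hmem s i).integrable_mul (hmem r j)
  simp only [eval, Finset.sum_mul_sum]
  rw [integral_finsetSum _ fun i _ => integrable_finsetSum _ fun j _ => hint i j]
  refine Finset.sum_congr rfl fun i _ => ?_
  rw [integral_finsetSum _ fun j _ => hint i j]
  exact Finset.sum_congr rfl fun j _ => setIntegral_indicator_mul_indicator measurableSet_Ioc
    measurableSet_Ioc (Ioc_subset_Ioc (s.a i).coe_nonneg (s.b_le i)) _ _

lemma covariance_wiener (hW : IsPreBrownianReal W P) (s r : StepFn t) :
    cov[s.wiener W, r.wiener W; P] = ∫ τ in Ioc 0 t, s.eval τ * r.eval τ := by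
  have : IsProbabilityMeasure P := hW.isGaussianProcess.isProbabilityMeasure
  have hmem (q : StepFn t) (i) : MemLp (fun ω => q.c i * (W (q.b i) ω - W (q.a i) ω)) 2 P :=
    (memLp_sub_of_isPreBrownianReal hW _ _).const_mul _
  unfold wiener
  rw [covariance_fun_sum_fun_sum (hmem s) (hmem r), integral_eval_mul_eval]
  simp only [covariance_const_mul_left, covariance_const_mul_right,
    covariance_sub_sub_of_isPreBrownianReal hW (s.a_le_b _) (r.a_le_b _), mul_assoc, mul_left_comm]

/-- The Wiener integral of a step function as an element of `L²(P)`. -/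
noncomputable def wienerL2 (hW : IsPreBrownianReal W P) (s : StepFn t) : Lp ℝ 2 P :=
  (s.memLp_wiener hW).toLp

lemma inner_wienerL2 (hW : IsPreBrownianReal W P) (s r : StepFn t) :
    inner ℝ (s.wienerL2 hW) (r.wienerL2 hW) = inner ℝ s.toL2 r.toL2 := by
  have : IsProbabilityMeasure P := hW.isGaussianProcess.isProbabilityMeasure
  have hcov := covariance_eq_sub (s.memLp_wiener hW) (r.memLp_wiener hW)
  rw [s.integral_wiener hW, zero_mul, sub_zero, s.covariance_wiener hW] at hcov
  simp only [wienerL2, toL2, inner_toLp_eq_integral_mul, hcov, Pi.mul_apply]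

lemma dist_wienerL2 (hW : IsPreBrownianReal W P) (s r : StepFn t) :
    dist (s.wienerL2 hW) (r.wienerL2 hW) = dist s.toL2 r.toL2 := by
  rw [dist_eq_norm, dist_eq_norm, ← sq_eq_sq₀ (norm_nonneg _) (norm_nonneg _),
    ← real_inner_self_eq_norm_sq, ← real_inner_self_eq_norm_sq]
  simp only [inner_sub_left, inner_sub_right, inner_wienerL2]

end StepFn

lemma exists_isWienerIntegral (hW : IsPreBrownianReal W P) (ht : 0 ≤ t) {k : ℝ → ℝ}
    (hk : MemLp k 2 (volume.restrict (Ioc 0 t))) : ∃ X, IsWienerIntegral W P t k X := by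
  obtain ⟨s, hs⟩ := StepFn.exists_tendsto_toL2 ht hk.toLp
  have hcauchy : CauchySeq fun j => (s j).wienerL2 hW := by
    have hs_cauchy := hs.cauchySeq
    rw [Metric.cauchySeq_iff] at hs_cauchy ⊢
    simpa only [StepFn.dist_wienerL2] using hs_cauchy
  obtain ⟨X, hX⟩ := cauchySeq_tendsto_of_complete hcauchy
  rw [← Lp.toLp_coeFn X (Lp.memLp X)] at hX
  exact ⟨X, Lp.memLp X, s,
    (Lp.tendsto_Lp_iff_tendsto_eLpNorm'' _ (fun j => (s j).memLp_eval) _ hk).1 hs,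
    (Lp.tendsto_Lp_iff_tendsto_eLpNorm'' _ (fun j => (s j).memLp_wiener hW) _ (Lp.memLp X)).1 hX⟩

lemma isWienerIntegral_wienerIntegral (hW : IsPreBrownianReal W P) (ht : 0 ≤ t) {k : ℝ → ℝ}
    (hk : MemLp k 2 (volume.restrict (Ioc 0 t))) :
    IsWienerIntegral W P t k (wienerIntegral W P t k) := by
  have hex := exists_isWienerIntegral hW ht hk
  rw [wienerIntegral, dif_pos hex]
  exact hex.choose_spec

namespace IsWienerIntegral

variable {k l : ℝ → ℝ} {X Y : Ω → ℝ}

lemma exists_tendsto_toLp (hW : IsPreBrownianReal W P) (hX : IsWienerIntegral W P t k X)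
    (hk : MemLp k 2 (volume.restrict (Ioc 0 t))) : ∃ s : ℕ → StepFn t,
      Tendsto (fun j => (s j).toL2) atTop (𝓝 hk.toLp) ∧
      Tendsto (fun j => (s j).wienerL2 hW) atTop (𝓝 hX.1.toLp) := by
  obtain ⟨s, hs, hsX⟩ := hX.2
  exact ⟨s, (Lp.tendsto_Lp_iff_tendsto_eLpNorm'' _ (fun j => (s j).memLp_eval) _ hk).2 hs,
    (Lp.tendsto_Lp_iff_tendsto_eLpNorm'' _ (fun j => (s j).memLp_wiener hW) _ hX.1).2 hsX⟩

lemma integral_eq_zero (hW : IsPreBrownianReal W P) (hX : IsWienerIntegral W P t k X)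
    (hk : MemLp k 2 (volume.restrict (Ioc 0 t))) : P[X] = 0 := by
  have : IsProbabilityMeasure P := hW.isGaussianProcess.isProbabilityMeasure
  obtain ⟨s, -, hs⟩ := hX.exists_tendsto_toLp hW hk
  have hone : MemLp (fun _ : Ω => (1 : ℝ)) 2 P := memLp_const 1
  have hstep (j) : inner ℝ ((s j).wienerL2 hW) hone.toLp = 0 :=
    (inner_toLp_eq_integral_mul _ _).trans (by simpa using (s j).integral_wiener hW)
  have hlim := (hs.inner (𝕜 := ℝ) (tendsto_const_nhds (x := hone.toLp))).congr hstep
  have hinner := tendsto_nhds_unique hlim tendsto_const_nhds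
  rw [inner_toLp_eq_integral_mul] at hinner
  simpa using hinner

lemma covariance_eq (hW : IsPreBrownianReal W P) (hX : IsWienerIntegral W P t k X)
    (hY : IsWienerIntegral W P t l Y) (hk : MemLp k 2 (volume.restrict (Ioc 0 t)))
    (hl : MemLp l 2 (volume.restrict (Ioc 0 t))) :
    cov[X, Y; P] = ∫ τ in Ioc 0 t, k τ * l τ := by
  have : IsProbabilityMeasure P := hW.isGaussianProcess.isProbabilityMeasure
  obtain ⟨s, hs, hsX⟩ := hX.exists_tendsto_toLp hW hk
  obtain ⟨r, hr, hrY⟩ := hY.exists_tendsto_toLp hW hl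
  have hlim := hsX.inner (𝕜 := ℝ) hrY
  simp only [StepFn.inner_wienerL2] at hlim
  have hinner := tendsto_nhds_unique hlim (hs.inner hr)
  rw [inner_toLp_eq_integral_mul, inner_toLp_eq_integral_mul] at hinner
  rw [covariance_eq_sub hX.1 hY.1, hX.integral_eq_zero hW hk, zero_mul, sub_zero, ← hinner]
  rfl

end IsWienerIntegral

end Wiener

/-! ### Hilbert bases and square-summable coefficients -/

section HilbertBasis

variable {ι E : Type*} [NormedAddCommGroup E] [InnerProductSpace ℝ E] (b : HilbertBasis ι ℝ E)

lemma hilbertBasis_repr_eq_inner (x : E) (n : ι) : b.repr x n = inner ℝ x (b n) :=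
  (b.repr_apply_apply x n).trans (real_inner_comm _ _)

lemma memℓp_inner_hilbertBasis (x : E) : Memℓp (fun n => inner ℝ x (b n)) 2 := by
  simpa only [← hilbertBasis_repr_eq_inner] using lp.memℓp (b.repr x)

lemma inner_tsum_smul_hilbertBasis {c : ι → ℝ} (hc : Memℓp c 2) (n : ι) :
    inner ℝ (∑' i, c i • b i) (b n) = c n := by
  have hsum : HasSum (fun i => c i • b i) (b.repr.symm ⟨c, hc⟩) := b.hasSum_repr_symm ⟨c, hc⟩
  rw [hsum.tsum_eq, ← hilbertBasis_repr_eq_inner, LinearIsometryEquiv.apply_symm_apply]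

variable {b}

lemma eq_of_forall_inner_hilbertBasis_eq {x y : E}
    (hxy : ∀ n, inner ℝ x (b n) = inner ℝ y (b n)) : x = y :=
  b.repr.injective <| lp.ext <| funext <| by simpa only [hilbertBasis_repr_eq_inner] using hxy

lemma eq_or_eq_neg_of_inner_mul_inner_eq {x y : E} {N : ι} (hN : inner ℝ y (b N) ≠ 0)
    (hxy : ∀ n, inner ℝ x (b N) * inner ℝ x (b n) = inner ℝ y (b N) * inner ℝ y (b n)) :
    x = y ∨ x = -y := by
  rcases mul_self_eq_mul_self_iff.1 (hxy N) with hx | hx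
  · refine .inl (eq_of_forall_inner_hilbertBasis_eq (b := b) fun n => mul_left_cancel₀ hN ?_)
    rw [← hxy n, hx]
  · refine .inr (eq_of_forall_inner_hilbertBasis_eq (b := b) fun n => mul_left_cancel₀ hN ?_)
    rw [inner_neg_left, mul_neg, ← hxy n, hx, neg_mul, neg_neg]

end HilbertBasis

lemma ae_memℓp_of_summable_integral_norm_rpow {ι X E : Type*} [Countable ι] [MeasurableSpace X]
    {μ : Measure X} [NormedAddCommGroup E] {p : ℝ≥0∞} (hp0 : p ≠ 0) (hp : p ≠ ⊤)
    {F : ι → X → E} (hF : ∀ i, MemLp (F i) p μ)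
    (hsum : Summable fun i => ∫ x, ‖F i x‖ ^ p.toReal ∂μ) :
    ∀ᵐ x ∂μ, Memℓp (fun i => F i x) p := by
  have hint (i) : Integrable (fun x => ‖F i x‖ ^ p.toReal) μ := (hF i).integrable_norm_rpow hp0 hp
  have hnorm (i x) : ‖‖F i x‖ ^ p.toReal‖ = ‖F i x‖ ^ p.toReal :=
    Real.norm_of_nonneg (Real.rpow_nonneg (norm_nonneg _) _)
  have hfin : ∑' i, eLpNorm (fun x => ‖F i x‖ ^ p.toReal) 1 μ ≠ ⊤ := by
    simp only [eLpNorm_one_eq_lintegral_enorm, ← ofReal_integral_norm_eq_lintegral_enorm (hint _),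
      hnorm]
    exact hsum.tsum_ofReal_ne_top
  filter_upwards [summable_norm_of_tsum_eLpNorm_ne_top le_rfl
    (fun i => (hint i).aestronglyMeasurable) hfin] with x hx
  exact memℓp_gen (by simpa only [hnorm] using hx)

/-! ### Coefficients of the mild solution -/

section StochConv

variable {Ω : Type*} [MeasurableSpace Ω] {P : Measure Ω} {W : ℝ≥0 → Ω → ℝ} {α t μ ν : ℝ}

/-- The stochastic convolution `∫₀ᵗ (t-τ)^{α-1} E_{α,α}(-μ (t-τ)^α) dW(τ)`. -/
noncomputable def stochConv (W : ℝ≥0 → Ω → ℝ) (P : Measure Ω) (α t μ : ℝ) : Ω → ℝ :=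
  wienerIntegral W P t fun τ => kernel α μ (t - τ)

lemma isWienerIntegral_stochConv (hW : IsPreBrownianReal W P) (hα : 1 / 2 < α) (hα1 : α ≤ 1)
    (ht : 0 ≤ t) (hμ : 0 ≤ μ) :
    IsWienerIntegral W P t (fun τ => kernel α μ (t - τ)) (stochConv W P α t μ) :=
  isWienerIntegral_wienerIntegral hW ht (memLp_kernel_sub hα hα1 hμ t)

lemma memLp_stochConv (hW : IsPreBrownianReal W P) (hα : 1 / 2 < α) (hα1 : α ≤ 1)
    (ht : 0 ≤ t) (hμ : 0 ≤ μ) : MemLp (stochConv W P α t μ) 2 P :=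
  (isWienerIntegral_stochConv hW hα hα1 ht hμ).1

lemma integral_stochConv (hW : IsPreBrownianReal W P) (hα : 1 / 2 < α) (hα1 : α ≤ 1)
    (ht : 0 ≤ t) (hμ : 0 ≤ μ) : P[stochConv W P α t μ] = 0 :=
  (isWienerIntegral_stochConv hW hα hα1 ht hμ).integral_eq_zero hW (memLp_kernel_sub hα hα1 hμ t)

lemma covariance_stochConv (hW : IsPreBrownianReal W P) (hα : 1 / 2 < α) (hα1 : α ≤ 1)
    (ht : 0 ≤ t) (hμ : 0 ≤ μ) (hν : 0 ≤ ν) :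
    cov[stochConv W P α t μ, stochConv W P α t ν; P] = covWeight α t μ ν := by
  rw [(isWienerIntegral_stochConv hW hα hα1 ht hμ).covariance_eq hW
    (isWienerIntegral_stochConv hW hα hα1 ht hν) (memLp_kernel_sub hα hα1 hμ t)
    (memLp_kernel_sub hα hα1 hν t), integral_kernel_sub_mul_kernel_sub ht]

lemma integral_stochConv_sq (hW : IsPreBrownianReal W P) (hα : 1 / 2 < α) (hα1 : α ≤ 1)
    (ht : 0 ≤ t) (hμ : 0 ≤ μ) : ∫ ω, stochConv W P α t μ ω ^ 2 ∂P = covWeight α t μ μ := by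
  have hmeas := (memLp_stochConv hW hα hα1 ht hμ).aestronglyMeasurable.aemeasurable
  rw [← covariance_stochConv hW hα hα1 ht hμ hμ, covariance_self hmeas,
    variance_of_integral_eq_zero hmeas (integral_stochConv hW hα hα1 ht hμ)]

lemma ae_memℓp_mul_stochConv {ι : Type*} [Countable ι] (hW : IsPreBrownianReal W P)
    (hα : 1 / 2 < α) (hα1 : α ≤ 1) (ht : 0 ≤ t) {lam : ι → ℝ} (hlam : ∀ n, 0 ≤ lam n)
    {c : ι → ℝ} (hc : Memℓp c 2) :
    ∀ᵐ ω ∂P, Memℓp (fun n => c n * stochConv W P α t (lam n) ω) 2 := by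
  refine ae_memℓp_of_summable_integral_norm_rpow two_ne_zero ENNReal.ofNat_ne_top
    (fun n => (memLp_stochConv hW hα hα1 ht (hlam n)).const_mul (c n)) ?_
  have hsq : Summable fun n => c n ^ 2 := by simpa using hc.summable (by norm_num)
  refine (hsq.mul_right (∫ τ in Ioo 0 t, (τ ^ (α - 1) / Real.Gamma α) ^ 2)).of_nonneg_of_le
    (fun n => by positivity) fun n => ?_
  calc ∫ ω, ‖c n * stochConv W P α t (lam n) ω‖ ^ (2 : ℝ≥0∞).toReal ∂P
      = c n ^ 2 * covWeight α t (lam n) (lam n) := by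
        simp only [ENNReal.toReal_ofNat, Real.rpow_ofNat, Real.norm_eq_abs, sq_abs, mul_pow]
        rw [integral_const_mul, integral_stochConv_sq hW hα hα1 ht (hlam n)]
    _ ≤ c n ^ 2 * ∫ τ in Ioo 0 t, (τ ^ (α - 1) / Real.Gamma α) ^ 2 :=
        mul_le_mul_of_nonneg_left (covWeight_self_le hα hα1 ht (hlam n)) (sq_nonneg _)

end StochConv

lemma covariance_congr_ae {Ω : Type*} [MeasurableSpace Ω] {P : Measure Ω} {X X' Y Y' : Ω → ℝ}
    (hX : X =ᵐ[P] X') (hY : Y =ᵐ[P] Y') : cov[X, Y; P] = cov[X', Y'; P] := by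
  rw [covariance, covariance, integral_congr_ae hX, integral_congr_ae hY]
  refine integral_congr_ae ?_
  filter_upwards [hX, hY] with ω hXω hYω
  rw [hXω, hYω]

namespace IsMildSolution

variable {d : ℕ} {D : TopologicalSpace.Opens (EuclideanSpace ℝ (Fin d))}
  {Ω : Type*} [MeasurableSpace Ω] {P : Measure Ω} {W : ℝ≥0 → Ω → ℝ}
  {α T t : ℝ} {lam : ℕ → ℝ} {φ : HilbertBasis ℕ ℝ (L2 D)} {h : ℝ → ℝ}
  {f g f' g' : L2 D} {u u' : ℝ → Ω → L2 D} {N : ℕ}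

lemma coeff_ae_eq (hu : IsMildSolution α T lam φ h W P f g u) (hW : IsPreBrownianReal W P)
    (hα : 1 / 2 < α) (hα1 : α ≤ 1) (ht : t ∈ Icc 0 T) (hlam : ∀ n, 0 ≤ lam n)
    (hh : MemLp h 2 (volume.restrict (Ioo 0 t))) (n : ℕ) :
    coeff φ u n t =ᵐ[P] fun ω => inner ℝ f (φ n) * meanWeight α t (lam n) h
      + inner ℝ g (φ n) * stochConv W P α t (lam n) ω := by
  have hdet : Memℓp (fun n => inner ℝ f (φ n) * meanWeight α t (lam n) h) 2 := by
    refine (((memℓp_inner_hilbertBasis φ f).norm).const_mul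
      (∫ τ in Ioo 0 t, ‖τ ^ (α - 1) / Real.Gamma α * h (t - τ)‖)).mono fun n => ?_
    rw [norm_mul, mul_comm]
    exact mul_le_mul_of_nonneg_right (norm_meanWeight_le hα hα1 ht.1 (hlam n) hh) (norm_nonneg _)
  filter_upwards [hu t ht, ae_memℓp_mul_stochConv hW hα hα1 ht.1 hlam
    (memℓp_inner_hilbertBasis φ g)] with ω hω hstoch
  rw [coeff, hω]
  simp only [detPart, stochPart, integral_kernel_sub_mul]
  exact inner_tsum_smul_hilbertBasis φ (hdet.add hstoch) n

lemma memLp_coeff (hu : IsMildSolution α T lam φ h W P f g u) (hW : IsPreBrownianReal W P)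
    (hα : 1 / 2 < α) (hα1 : α ≤ 1) (ht : t ∈ Icc 0 T) (hlam : ∀ n, 0 ≤ lam n)
    (hh : MemLp h 2 (volume.restrict (Ioo 0 t))) (n : ℕ) : MemLp (coeff φ u n t) 2 P := by
  have : IsProbabilityMeasure P := hW.isGaussianProcess.isProbabilityMeasure
  rw [memLp_congr_ae (hu.coeff_ae_eq hW hα hα1 ht hlam hh n)]
  exact (memLp_const (inner ℝ f (φ n) * meanWeight α t (lam n) h)).add
    ((memLp_stochConv hW hα hα1 ht.1 (hlam n)).const_mul (inner ℝ g (φ n)))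

lemma integral_coeff (hu : IsMildSolution α T lam φ h W P f g u) (hW : IsPreBrownianReal W P)
    (hα : 1 / 2 < α) (hα1 : α ≤ 1) (ht : t ∈ Icc 0 T) (hlam : ∀ n, 0 ≤ lam n)
    (hh : MemLp h 2 (volume.restrict (Ioo 0 t))) (n : ℕ) :
    P[coeff φ u n t] = inner ℝ f (φ n) * meanWeight α t (lam n) h := by
  have : IsProbabilityMeasure P := hW.isGaussianProcess.isProbabilityMeasure
  have hint := (memLp_stochConv hW hα hα1 ht.1 (hlam n)).integrable one_le_two
  rw [integral_congr_ae (hu.coeff_ae_eq hW hα hα1 ht hlam hh n),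
    integral_add (integrable_const _) (hint.const_mul _), integral_const, integral_const_mul,
    integral_stochConv hW hα hα1 ht.1 (hlam n), probReal_univ, one_smul, mul_zero, add_zero]

lemma covariance_coeff (hu : IsMildSolution α T lam φ h W P f g u) (hW : IsPreBrownianReal W P)
    (hα : 1 / 2 < α) (hα1 : α ≤ 1) (ht : t ∈ Icc 0 T) (hlam : ∀ n, 0 ≤ lam n)
    (hh : MemLp h 2 (volume.restrict (Ioo 0 t))) (m n : ℕ) :
    cov[coeff φ u m t, coeff φ u n t; P]
      = inner ℝ g (φ m) * inner ℝ g (φ n) * covWeight α t (lam m) (lam n) := by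
  have : IsProbabilityMeasure P := hW.isGaussianProcess.isProbabilityMeasure
  have hint (n) : Integrable (fun ω => inner ℝ g (φ n) * stochConv W P α t (lam n) ω) P :=
    ((memLp_stochConv hW hα hα1 ht.1 (hlam n)).integrable one_le_two).const_mul _
  rw [covariance_congr_ae (hu.coeff_ae_eq hW hα hα1 ht hlam hh m)
      (hu.coeff_ae_eq hW hα hα1 ht hlam hh n),
    covariance_const_add_left (hint m), covariance_const_add_right (hint n),
    covariance_const_mul_left, covariance_const_mul_right,
    covariance_stochConv hW hα hα1 ht.1 (hlam m) (hlam n), mul_assoc]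

lemma variance_coeff (hu : IsMildSolution α T lam φ h W P f g u) (hW : IsPreBrownianReal W P)
    (hα : 1 / 2 < α) (hα1 : α ≤ 1) (ht : t ∈ Icc 0 T) (hlam : ∀ n, 0 ≤ lam n)
    (hh : MemLp h 2 (volume.restrict (Ioo 0 t))) (n : ℕ) :
    Var[coeff φ u n t; P] = inner ℝ g (φ n) ^ 2 * covWeight α t (lam n) (lam n) := by
  rw [← covariance_self (hu.memLp_coeff hW hα hα1 ht hlam hh n).aestronglyMeasurable.aemeasurable,
    hu.covariance_coeff hW hα hα1 ht hlam hh, sq]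

lemma sqrt_variance_coeff_div (hu : IsMildSolution α T lam φ h W P f g u)
    (hW : IsPreBrownianReal W P) (hα : 1 / 2 < α) (hα1 : α ≤ 1) (ht : t ∈ Ioc 0 T)
    (hlam : ∀ n, 0 ≤ lam n) (hh : MemLp h 2 (volume.restrict (Ioo 0 t))) (n : ℕ) :
    √(Var[coeff φ u n t; P] / covWeight α t (lam n) (lam n)) = |inner ℝ g (φ n)| := by
  have hK := covWeight_pos hα hα1 ht.1 (hlam n) (hlam n)
  rw [hu.variance_coeff hW hα hα1 (Ioc_subset_Icc_self ht) hlam hh,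
    mul_div_cancel_right₀ _ hK.ne', Real.sqrt_sq_eq_abs]

lemma exists_sign_mul_inner_eq (hu : IsMildSolution α T lam φ h W P f g u)
    (hW : IsPreBrownianReal W P) (hα : 1 / 2 < α) (hα1 : α ≤ 1) (ht : t ∈ Ioc 0 T)
    (hlam : ∀ n, 0 ≤ lam n) (hh : MemLp h 2 (volume.restrict (Ioo 0 t)))
    (hN : inner ℝ g (φ N) ≠ 0) :
    ∃ s : ℝ, (s = 1 ∨ s = -1) ∧ ∀ n, s * inner ℝ g (φ n) = cov[coeff φ u N t, coeff φ u n t; P] /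
      (√(Var[coeff φ u N t; P] / covWeight α t (lam N) (lam N))
        * covWeight α t (lam N) (lam n)) := by
  have hK (n) := (covWeight_pos hα hα1 ht.1 (hlam N) (hlam n)).ne'
  obtain ⟨s, hs, hsN⟩ : ∃ s : ℝ, (s = 1 ∨ s = -1) ∧
      s * |inner ℝ g (φ N)| = inner ℝ g (φ N) := by
    rcases abs_choice (inner ℝ g (φ N)) with habs | habs
    · exact ⟨1, .inl rfl, by rw [one_mul, habs]⟩
    · exact ⟨-1, .inr rfl, by rw [neg_one_mul, habs, neg_neg]⟩
  refine ⟨s, hs, fun n => ?_⟩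
  rw [hu.sqrt_variance_coeff_div hW hα hα1 ht hlam hh,
    hu.covariance_coeff hW hα hα1 (Ioc_subset_Icc_self ht) hlam hh,
    mul_div_mul_right _ _ (hK n), eq_div_iff (abs_ne_zero.2 hN), mul_right_comm, hsN]

lemma eq_of_integral_coeff_eq (hu : IsMildSolution α T lam φ h W P f g u)
    (hu' : IsMildSolution α T lam φ h W P f' g' u') (hW : IsPreBrownianReal W P)
    (hα : 1 / 2 < α) (hα1 : α ≤ 1) (ht : t ∈ Icc 0 T) (hlam : ∀ n, 0 ≤ lam n)
    (hh : MemLp h 2 (volume.restrict (Ioo 0 t))) (hM : ∀ n, meanWeight α t (lam n) h ≠ 0)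
    (heq : ∀ n, P[coeff φ u' n t] = P[coeff φ u n t]) : f' = f := by
  simp only [hu.integral_coeff hW hα hα1 ht hlam hh, hu'.integral_coeff hW hα hα1 ht hlam hh] at heq
  exact eq_of_forall_inner_hilbertBasis_eq fun n => mul_right_cancel₀ (hM n) (heq n)

lemma eq_or_eq_neg_of_covariance_coeff_eq (hu : IsMildSolution α T lam φ h W P f g u)
    (hu' : IsMildSolution α T lam φ h W P f' g' u') (hW : IsPreBrownianReal W P)
    (hα : 1 / 2 < α) (hα1 : α ≤ 1) (ht : t ∈ Ioc 0 T) (hlam : ∀ n, 0 ≤ lam n)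
    (hh : MemLp h 2 (volume.restrict (Ioo 0 t))) (hN : inner ℝ g (φ N) ≠ 0)
    (heq : ∀ n, cov[coeff φ u' N t, coeff φ u' n t; P] = cov[coeff φ u N t, coeff φ u n t; P]) :
    g' = g ∨ g' = -g := by
  have ht' := Ioc_subset_Icc_self ht
  simp only [hu.covariance_coeff hW hα hα1 ht' hlam hh,
    hu'.covariance_coeff hW hα hα1 ht' hlam hh] at heq
  exact eq_or_eq_neg_of_inner_mul_inner_eq hN fun n =>
    mul_right_cancel₀ (covWeight_pos hα hα1 ht.1 (hlam N) (hlam n)).ne' (heq n)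

end IsMildSolution

end SFDE

theorem theorem2_general {d : ℕ} {D : TopologicalSpace.Opens (EuclideanSpace ℝ (Fin d))}
    {lam : ℕ → ℝ} (hlam : ∀ n, 0 ≤ lam n) {φ : HilbertBasis ℕ ℝ (SFDE.L2 D)}
    {α T : ℝ} (hα : 1 / 2 < α) (hα1 : α ≤ 1) (hT : 0 < T)
    {h : ℝ → ℝ} (hh : MemLp h 2 (volume.restrict (Ioo 0 T)))
    (hh0 : 0 ≤ᵐ[volume.restrict (Ioo 0 T)] h) (hne : ¬ h =ᵐ[volume.restrict (Ioo 0 T)] 0)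
    {Ω : Type*} [MeasurableSpace Ω] {P : Measure Ω}
    {W : ℝ≥0 → Ω → ℝ} (hW : IsPreBrownianReal W P)
    {f g : SFDE.L2 D} {N₀ : ℕ} (hN₀ : inner ℝ g (φ N₀) ≠ 0)
    {u : ℝ → Ω → SFDE.L2 D} (hu : SFDE.IsMildSolution α T lam φ h W P f g u) :
    (∀ n, MemLp (SFDE.coeff φ u n T) 2 P) ∧
    (∀ n, 0 < SFDE.meanWeight α T (lam n) h ∧
      inner ℝ f (φ n) = P[SFDE.coeff φ u n T] / SFDE.meanWeight α T (lam n) h) ∧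
    (∀ n, 0 < SFDE.covWeight α T (lam N₀) (lam n)) ∧
    0 < Var[SFDE.coeff φ u N₀ T; P] ∧
    |inner ℝ g (φ N₀)| =
      √(Var[SFDE.coeff φ u N₀ T; P] / SFDE.covWeight α T (lam N₀) (lam N₀)) ∧
    (∃ s : ℝ, (s = 1 ∨ s = -1) ∧ ∀ n, s * inner ℝ g (φ n) =
      cov[SFDE.coeff φ u N₀ T, SFDE.coeff φ u n T; P] /
        (√(Var[SFDE.coeff φ u N₀ T; P] / SFDE.covWeight α T (lam N₀) (lam N₀))
          * SFDE.covWeight α T (lam N₀) (lam n))) ∧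
    (∀ (f' g' : SFDE.L2 D) (u' : ℝ → Ω → SFDE.L2 D),
      SFDE.IsMildSolution α T lam φ h W P f' g' u' →
      (∀ n, P[SFDE.coeff φ u' n T] = P[SFDE.coeff φ u n T]) →
      (∀ n, cov[SFDE.coeff φ u' N₀ T, SFDE.coeff φ u' n T; P]
        = cov[SFDE.coeff φ u N₀ T, SFDE.coeff φ u n T; P]) →
      f' = f ∧ (g' = g ∨ g' = -g) ∧ |g'| = |g|) := by
  have ht : T ∈ Icc 0 T := ⟨hT.le, le_rfl⟩
  have ht0 : T ∈ Ioc 0 T := ⟨hT, le_rfl⟩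
  have hM (n) : 0 < SFDE.meanWeight α T (lam n) h :=
    SFDE.meanWeight_pos hα hα1 hT.le (hlam n) hh hh0 hne
  have hK (n) : 0 < SFDE.covWeight α T (lam N₀) (lam n) :=
    SFDE.covWeight_pos hα hα1 hT (hlam N₀) (hlam n)
  refine ⟨hu.memLp_coeff hW hα hα1 ht hlam hh, fun n => ⟨hM n, ?_⟩, hK, ?_,
    (hu.sqrt_variance_coeff_div hW hα hα1 ht0 hlam hh N₀).symm,
    hu.exists_sign_mul_inner_eq hW hα hα1 ht0 hlam hh hN₀, fun f' g' u' hu' hE hcov => ?_⟩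
  · rw [hu.integral_coeff hW hα hα1 ht hlam hh, mul_div_cancel_right₀ _ (hM n).ne']
  · rw [hu.variance_coeff hW hα hα1 ht hlam hh]
    exact mul_pos (sq_pos_of_ne_zero hN₀) (hK N₀)
  · have hf := hu.eq_of_integral_coeff_eq hu' hW hα hα1 ht hlam hh (fun n => (hM n).ne') hE
    have hg := hu.eq_or_eq_neg_of_covariance_coeff_eq hu' hW hα hα1 ht0 hlam hh hN₀ hcov
    exact ⟨hf, hg, hg.elim (congrArg _) fun hneg => hneg ▸ abs_neg g⟩

theorem theorem2 {d : ℕ} (D : TopologicalSpace.Opens (EuclideanSpace ℝ (Fin d)))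
    (hD : Bornology.IsBounded (D : Set (EuclideanSpace ℝ (Fin d))))
    (A : SFDE.DiffOperator d) (hA : A.IsAdmissible D)
    (lam : ℕ → ℝ) (φ : HilbertBasis ℕ ℝ (SFDE.L2 D)) (hφ : SFDE.IsEigensystem A lam φ)
    (α T : ℝ) (hα : α ∈ Ioo (1 / 2 : ℝ) 1) (hT : 0 < T)
    (h : ℝ → ℝ) (hh : MemLp h ⊤ (volume.restrict (Ioo 0 T)))
    (c_h : ℝ) (hc : 0 < c_h) (hhc : ∀ᵐ t ∂(volume.restrict (Ioo 0 T)), c_h ≤ h t)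
    {Ω : Type*} [MeasurableSpace Ω] (P : Measure Ω) [IsProbabilityMeasure P]
    (W : ℝ≥0 → Ω → ℝ) (hW : IsBrownianReal W P)
    (f g : SFDE.L2 D) (hg0 : g ≠ 0) (hg : SFDE.MemH2 g)
    (N₀ : ℕ) (hN₀ : inner ℝ g (φ N₀) ≠ 0)
    (u : ℝ → Ω → SFDE.L2 D) (hu : SFDE.IsMildSolution α T lam φ h W P f g u) :
    -- the data are well defined
    (∀ n, MemLp (SFDE.coeff φ u n T) 2 P) ∧
    -- coefficient-wise recovery of `f`
    (∀ n, 0 < SFDE.meanWeight α T (lam n) h ∧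
      inner ℝ f (φ n) = P[SFDE.coeff φ u n T] / SFDE.meanWeight α T (lam n) h) ∧
    -- coefficient-wise recovery of `g` up to a global sign
    (∀ n, 0 < SFDE.covWeight α T (lam N₀) (lam n)) ∧
    0 < Var[SFDE.coeff φ u N₀ T; P] ∧
    |inner ℝ g (φ N₀)| =
      √(Var[SFDE.coeff φ u N₀ T; P] / SFDE.covWeight α T (lam N₀) (lam N₀)) ∧
    (∃ s : ℝ, (s = 1 ∨ s = -1) ∧ ∀ n, s * inner ℝ g (φ n) =
      cov[SFDE.coeff φ u N₀ T, SFDE.coeff φ u n T; P] /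
        (√(Var[SFDE.coeff φ u N₀ T; P] / SFDE.covWeight α T (lam N₀) (lam N₀))
          * SFDE.covWeight α T (lam N₀) (lam n))) ∧
    -- uniqueness: sources with the same data have the same `f` and the same `|g|`,
    -- and indeed the same `g` up to a global sign
    (∀ (f' g' : SFDE.L2 D) (u' : ℝ → Ω → SFDE.L2 D), SFDE.MemH2 g' →
      SFDE.IsMildSolution α T lam φ h W P f' g' u' →
      (∀ n, P[SFDE.coeff φ u' n T] = P[SFDE.coeff φ u n T]) →
      Var[SFDE.coeff φ u' N₀ T; P] = Var[SFDE.coeff φ u N₀ T; P] →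
      (∀ n, cov[SFDE.coeff φ u' N₀ T, SFDE.coeff φ u' n T; P]
        = cov[SFDE.coeff φ u N₀ T, SFDE.coeff φ u n T; P]) →
      f' = f ∧ (g' = g ∨ g' = -g) ∧ |g'| = |g|) := by
  obtain ⟨hL2, hf, hK, hVar, hgN, hsign, huniq⟩ := theorem2_general (fun n => (hφ.pos n).le) hα.1
    hα.2.le hT (hh.mono_exponent le_top) (hhc.mono fun t ht => hc.le.trans ht)
    (SFDE.not_ae_eq_zero_of_ae_le (by simpa using hT) hc hhc) hW.toIsPreBrownianReal hN₀ hu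
  exact ⟨hL2, hf, hK, hVar, hgN, hsign, fun f' g' u' _ hu' hE _ => huniq f' g' u' hu' hE⟩
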